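/- There are absolute constants $C>0$ and $d\in\mathbb N$ such that the following holds. Let $N$ be a finite ground set with $n=|N|\ge 2$ elements, let $p\ge 1$ be an integer and let $0<\varepsilon<1$. Let $\mathcal M$ be a $p$-matchoid on $N$, given by $m$ matroids $\mathcal M_i=(N_i,\mathcal I_i)$ with $N_i\subseteq N$, such that every element of $N$ lies in at most $p$ of the sets $N_i$; a set $S\subseteq N$ is independent, $S\in\mathcal I$, if $S\cap N_i\in\mathcal I_i$ for all $i$. Let $f:2^N\to\mathbb R_{\ge 0}$ be a monotone submodular function with $f(\emptyset)=0$, let $\mathrm{OPT}=\max_{I\in\mathcal I}f(I)$, and let $F(x)=\mathbb E[f(S)]$ denote the multilinear extension of $f$, where $S$ contains each $e\in N$ independently with probability $\min\{x_e,1\}$. The algorithms below know $N$, the ground sets $N_i$, $p$ and $\varepsilon$, and access $f$ and the matroids only through a value oracle for $f$ and a rank oracle for each $\mathcal M_i$. Queries are made in (adaptive) rounds: the queries of one round are asked in parallel and depend only on the internal randomness and on the answers obtained in strictly earlier rounds. Computation other than oracle queries is not counted. 1. There is a randomized algorithm that always returns an independent set $I\in\mathcal I$, with $$\mathbb E[f(I)]\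 \ge\ \frac{1-\varepsilon}{p+1}\,\mathrm{OPT},$$ in at most $C\,\frac{\log^2 n}{\varepsilon^2}$ rounds in expectation, with at most $C\,(n+m+1/\varepsilon)^d$ oracle queries in each round. 2. There is a randomized algorithm that always returns a convex combination $x=\sum_j w_j\mathbf 1_{I_j}$ of at most $C/\varepsilon$ independent sets $I_j\in\mathcal I$, with $$\mathbb E[F(x)]\ \ge\ \bigl(1-e^{-1/p}-\varepsilon\bigr)\,\mathrm{OPT},$$ in at most $C\,\frac{\log^2 n}{\varepsilon^3}$ rounds in expectation, with at most $C\,(n+m+1/\varepsilon)^d$ oracle queries in each round. -/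

import Mathlib

/-! ### Submodular functions and the multilinear extension -/

/-- A normalized, nonnegative, monotone, submodular set function on the subsets of `α`. -/
structure IsMonotoneSubmodular {α : Type*} [DecidableEq α] (f : Finset α → ℝ) : Prop where
  normalized : f ∅ = 0
  nonneg : ∀ S, 0 ≤ f S
  monotone : ∀ S T, S ⊆ T → f S ≤ f T
  submodular : ∀ S T, f (S ∪ T) + f (S ∩ T) ≤ f S + f T

/-- The multilinear extension `F x = E[f(S)]`, where the random set `S` contains each element `e`
independently with probability `min (x e) 1`. -/
noncomputable def multilinearExtension {α : Type*} [Fintype α] [DecidableEq α]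
    (f : Finset α → ℝ) (x : α → ℝ) : ℝ :=
  ∑ S : Finset α, (∏ e ∈ S, min (x e) 1) * (∏ e ∈ Sᶜ, (1 - min (x e) 1)) * f S

/-! ### Matchoids -/

/-- A matchoid on the ground set `α`: a collection of matroids indexed by `ι`, the `i`-th of
which lives on its own ground set `(matroid i).E ⊆ α`. -/
structure Matchoid (α ι : Type*) where
  matroid : ι → Matroid α

namespace Matchoid

/-- The ground set of the `i`-th underlying matroid. -/
def groundSet {α ι : Type*} (M : Matchoid α ι) (i : ι) : Set α := (M.matroid i).E

/-- `M` is a `p`-matchoid: each element participates in at most `p` of the matroids. -/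
def IsPMatchoid {α ι : Type*} (M : Matchoid α ι) (p : ℕ) : Prop :=
  ∀ e : α, {i : ι | e ∈ M.groundSet i}.encard ≤ p

/-- A set is independent if its trace on each ground set is independent in that matroid. -/
def Indep {α ι : Type*} (M : Matchoid α ι) (S : Finset α) : Prop :=
  ∀ i : ι, (M.matroid i).Indep ((S : Set α) ∩ M.groundSet i)

/-- The optimum `max {f(I) | I independent}`. -/
noncomputable def opt {α ι : Type*} (M : Matchoid α ι) (f : Finset α → ℝ) : ℝ :=
  sSup (f '' {I : Finset α | M.Indep I})

theorem indep_empty {α ι : Type*} (M : Matchoid α ι) : M.Indep ∅ := by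
  intro i
  simp

/-- The supremum in the definition of `opt` is a maximum. -/
theorem isGreatest_opt {α ι : Type*} [Fintype α] (M : Matchoid α ι) (f : Finset α → ℝ) :
    IsGreatest (f '' {I : Finset α | M.Indep I}) (M.opt f) := by
  have hfin : (f '' {I : Finset α | M.Indep I}).Finite := (Set.toFinite _).image f
  have hne : (f '' {I : Finset α | M.Indep I}).Nonempty := ⟨f ∅, ∅, M.indep_empty, rfl⟩
  exact ⟨hne.csSup_mem hfin, fun _ hx => le_csSup hfin.bddAbove hx⟩

/-- `w` is (the weight function of) a convex combination of independent sets. -/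
structure IsConvexCombination {α ι : Type*} [Fintype α] [DecidableEq α] (M : Matchoid α ι)
    (w : Finset α → ℝ) : Prop where
  nonneg : ∀ S, 0 ≤ w S
  sum_eq_one : ∑ S, w S = 1
  indep : ∀ S, w S ≠ 0 → M.Indep S

end Matchoid

/-- The point `x = ∑ S, w S • 1_S` of `ℝ^α` given by the weights `w`. -/
noncomputable def pointOfWeights {α : Type*} [Fintype α] [DecidableEq α]
    (w : Finset α → ℝ) (e : α) : ℝ :=
  ∑ S : Finset α, if e ∈ S then w S else 0

/-! ### Adaptive randomized algorithms with oracle access -/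

/-- A randomized algorithm that asks queries from `Q` with answers in `A` and ends with an output
in `Out`. It can stop, draw a random number (free of charge), or issue a *round*: a finite set of
queries that are asked in parallel. What it does after a round depends on the answers to
the queries of that round (and on all that happened before), so the queries of a round can depend
only on random choices and on answers obtained in strictly earlier rounds. -/
inductive AdaptiveAlg (Q A Out : Type*)
  | output (o : Out) : AdaptiveAlg Q A Out
  | random (μ : PMF ℕ) (next : ℕ → AdaptiveAlg Q A Out) : AdaptiveAlg Q A Out
  | round (qs : Finset Q) (next : (qs → A) → AdaptiveAlg Q A Out) : AdaptiveAlg Q A Out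

namespace AdaptiveAlg

/-- The distribution of the output, when the queries are answered by `oracle`. -/
noncomputable def run {Q A Out : Type*} (oracle : Q → A) : AdaptiveAlg Q A Out → PMF Out
  | output o => PMF.pure o
  | random μ next => μ.bind fun k => run oracle (next k)
  | round _ next => run oracle (next fun q => oracle q)

/-- The expected number of rounds (adaptivity), when the queries are answered by `oracle`. -/
noncomputable def expectedRounds {Q A Out : Type*} (oracle : Q → A) :
    AdaptiveAlg Q A Out → ENNReal
  | output _ => 0
  | random μ next => ∑' k, μ k * expectedRounds oracle (next k)
  | round _ next => 1 + expectedRounds oracle (next fun q => oracle q)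

/-- When the queries are answered by `oracle`, each round that occurs with positive probability
consists of at most `N` queries. -/
def QueriesPerRoundLE {Q A Out : Type*} (oracle : Q → A) (N : ℝ) : AdaptiveAlg Q A Out → Prop
  | output _ => True
  | random μ next => ∀ k ∈ μ.support, QueriesPerRoundLE oracle N (next k)
  | round qs next => (qs.card : ℝ) ≤ N ∧ QueriesPerRoundLE oracle N (next fun q => oracle q)

end AdaptiveAlg

/-- The queries: the value `f(S)`, or the rank of `S` in the `i`-th matroid. -/
inductive MatchoidQuery (α ι : Type*)
  | value (S : Finset α) : MatchoidQuery α ι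
  | rank (i : ι) (S : Finset α) : MatchoidQuery α ι

/-- The value oracle of `f`, together with the rank oracles of the matroids of `M`. -/
noncomputable def matchoidOracle {α ι : Type*} (M : Matchoid α ι) (f : Finset α → ℝ) :
    MatchoidQuery α ι → ℝ
  | MatchoidQuery.value S => f S
  | MatchoidQuery.rank i S => (((M.matroid i).eRk (S : Set α)).toNat : ℝ)

/-- The expected value of `h` under `μ`; it is only used for functions `h` that are bounded on the
support of `μ`, for which the sum converges. -/
noncomputable def expectation {β : Type*} (μ : PMF β) (h : β → ℝ) : ℝ :=
  ∑' b, (μ b).toReal * h b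

/-! Both algorithms run one parallel threshold greedy from a grid point x = c/K. It maintains the
set Q of all elements sampled so far and the set S ⊆ Q of accepted ones, and it judges every element
relative to Q instead of S. For a random ordering of the candidates it is therefore known in advance
which sets will be inspected: the prefixes added to Q. One round of queries thus decides the whole
walk (`walk_congr`). A walk stops as soon as a δ-fraction of its candidates is no longer good, so
about (log n)/δ walks exhaust a threshold (`card_filter_good_walk_le`); before it stops, the next
element is good with probability at least 1 - δ (`listExpect_walk_nonneg`).

For the value, let b be the sum over Q of the upper bounds U on the gains at sampling time, and a
the sum over S of the acceptance thresholds (1 - δ)U. Up to estimation errors, submodularity gives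
K(F(S) - F(x)) ≥ a and K(F(Q) - F(x)) ≤ b, where S and Q stand for x increased by their indicators
over K. An independent set O has at most p|Q| elements blocked by Q (`card_blocked_le`), at every
moment of the run; as the thresholds decrease, the gains of the blocked elements are at most pb, and
an unblocked element gains at most the last, tiny threshold. Hence f(O) - F(x) is at most (p + 1/K)b
plus a small term, while E[a] ≥ (1 - δ)²E[b] (`Inv`, `Inv.final`, `le_expect_greedy`).

With K = 1 and x = 0 the extension is f itself and the ratio is about 1/(p + 1). With K about 1/δ,
each of K phases closes about a 1/(pK)-fraction of the gap f(O) - F(x), leaving about e^{-1/p} of it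
(`le_expect_phases`).

Estimates of gains need no concentration inequality or union bound: all absolute errors are added up
in a quantity Δ, every inequality holds on each path up to a multiple of Δ, and only the mean of Δ
is bounded. The number of rounds is bounded on every path, not merely in expectation. -/

open scoped BigOperators

/-! ### Composition, expectation and resource bounds of adaptive algorithms. -/

namespace AdaptiveAlg

/-- Run an algorithm and continue with its output. -/
def bind {Q A Out Out' : Type*} :
    AdaptiveAlg Q A Out → (Out → AdaptiveAlg Q A Out') → AdaptiveAlg Q A Out'
  | output o, k => k o
  | random μ next, k => random μ fun i => bind (next i) k
  | round qs next, k => round qs fun a => bind (next a) k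

/-- The expected value of `h` at the output. -/
noncomputable def expect {Q A Out : Type*} (oracle : Q → A) (h : Out → ℝ) :
    AdaptiveAlg Q A Out → ℝ
  | output o => h o
  | random μ next => ∑' k, (μ k).toReal * expect oracle h (next k)
  | round _ next => expect oracle h (next fun q => oracle q)

/-- On every computation path with the given oracle there are at most `r` rounds, every round has
at most `N` queries, every random choice has finitely many outcomes, and the output
satisfies `P`. -/
def Ensures {Q A Out : Type*} (oracle : Q → A) (N : ℝ) (P : Out → Prop) :
    AdaptiveAlg Q A Out → ℕ → Prop
  | output o, _ => P o
  | random μ next, r => μ.support.Finite ∧ ∀ k ∈ μ.support, Ensures oracle N P (next k) r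
  | round qs next, r =>
      (qs.card : ℝ) ≤ N ∧ 0 < r ∧ Ensures oracle N P (next fun q => oracle q) (r - 1)

section
variable {Q A Out Out' : Type*} {oracle : Q → A} {N : ℝ}

theorem Ensures.mono {P P' : Out → Prop} (hP : ∀ o, P o → P' o) {alg : AdaptiveAlg Q A Out} :
    ∀ {r r' : ℕ}, r ≤ r' → alg.Ensures oracle N P r → alg.Ensures oracle N P' r' := by
  induction alg with
  | output o => intro r r' _ h; exact hP o h
  | random μ next ih => intro r r' hr h; exact ⟨h.1, fun k hk => ih k hr (h.2 k hk)⟩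
  | round qs next ih =>
    intro r r' hr h
    exact ⟨h.1, h.2.1.trans_le hr, ih _ (Nat.sub_le_sub_right hr 1) h.2.2⟩

theorem Ensures.mono_queries {P : Out → Prop} {N' : ℝ} (hN : N ≤ N') {alg : AdaptiveAlg Q A Out} :
    ∀ {r : ℕ}, alg.Ensures oracle N P r → alg.Ensures oracle N' P r := by
  induction alg with
  | output o => intro r h; exact h
  | random μ next ih => intro r h; exact ⟨h.1, fun k hk => ih k (h.2 k hk)⟩
  | round qs next ih => intro r h; exact ⟨h.1.trans hN, h.2.1, ih _ h.2.2⟩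

theorem Ensures.bind {P : Out → Prop} {P' : Out' → Prop} {alg : AdaptiveAlg Q A Out}
    {k : Out → AdaptiveAlg Q A Out'} {s : ℕ} (hk : ∀ o, P o → (k o).Ensures oracle N P' s) :
    ∀ {r : ℕ}, alg.Ensures oracle N P r → (alg.bind k).Ensures oracle N P' (r + s) := by
  induction alg with
  | output o => intro r h; exact (hk o h).mono (fun _ => id) (Nat.le_add_left _ _)
  | random μ next ih => intro r h; exact ⟨h.1, fun i hi => ih i (h.2 i hi)⟩
  | round qs next ih =>
    intro r h
    have h0 := h.2.1
    have := ih _ h.2.2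
    refine ⟨h.1, by omega, ?_⟩
    rwa [show r + s - 1 = r - 1 + s by omega]

theorem expect_bind (h : Out' → ℝ) (alg : AdaptiveAlg Q A Out) (k : Out → AdaptiveAlg Q A Out') :
    (alg.bind k).expect oracle h = alg.expect oracle fun o => (k o).expect oracle h := by
  induction alg with
  | output o => rfl
  | random μ next ih => simp only [bind, expect, ih]
  | round qs next ih => exact ih _

theorem Ensures.of_mem_support {P : Out → Prop} {alg : AdaptiveAlg Q A Out} :
    ∀ {r : ℕ}, alg.Ensures oracle N P r → ∀ o ∈ (alg.run oracle).support, P o := by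
  induction alg with
  | output o =>
    intro r h o' ho'
    rw [run, PMF.mem_support_pure_iff] at ho'
    exact ho' ▸ h
  | random μ next ih =>
    intro r h o ho
    rw [run, PMF.mem_support_bind_iff] at ho
    obtain ⟨k, hk, ho⟩ := ho
    exact ih k (h.2 k hk) o ho
  | round qs next ih => intro r h; exact ih _ h.2.2

theorem Ensures.queriesPerRoundLE {P : Out → Prop} {alg : AdaptiveAlg Q A Out} :
    ∀ {r : ℕ}, alg.Ensures oracle N P r → alg.QueriesPerRoundLE oracle N := by
  induction alg with
  | output o => intro r h; trivial
  | random μ next ih => intro r h k hk; exact ih k (h.2 k hk)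
  | round qs next ih => intro r h; exact ⟨h.1, ih _ h.2.2⟩

theorem Ensures.expectedRounds_le {P : Out → Prop} {alg : AdaptiveAlg Q A Out} :
    ∀ {r : ℕ}, alg.Ensures oracle N P r → alg.expectedRounds oracle ≤ r := by
  induction alg with
  | output o => intro r h; exact zero_le
  | random μ next ih =>
    intro r h
    calc ∑' k, μ k * (next k).expectedRounds oracle ≤ ∑' k, μ k * (r : ENNReal) := by
          refine ENNReal.tsum_le_tsum fun k => ?_
          by_cases hk : k ∈ μ.support
          · gcongr
            exact ih k (h.2 k hk)
          · rw [PMF.mem_support_iff, not_not] at hk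
            simp [hk]
      _ = r := by rw [ENNReal.tsum_mul_right, μ.tsum_coe, one_mul]
  | round qs next ih =>
    intro r h
    have h0 := h.2.1
    calc 1 + (next fun q => oracle q).expectedRounds oracle ≤ 1 + ((r - 1 : ℕ) : ENNReal) := by
          gcongr
          exact ih _ h.2.2
      _ = r := by
          rw [show (1 : ENNReal) = ((1 : ℕ) : ENNReal) by simp, ← Nat.cast_add]
          congr 1
          omega

theorem Ensures.support_finite {P : Out → Prop} {alg : AdaptiveAlg Q A Out} :
    ∀ {r : ℕ}, alg.Ensures oracle N P r → (alg.run oracle).support.Finite := by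
  induction alg with
  | output o => intro r h; rw [run, PMF.support_pure]; exact Set.finite_singleton o
  | random μ next ih =>
    intro r h
    rw [run, PMF.support_bind]
    exact h.1.biUnion fun k hk => ih k (h.2 k hk)
  | round qs next ih => intro r h; exact ih _ h.2.2

theorem _root_.expectation_eq_sum {β : Type*} (μ : PMF β) (h : β → ℝ) {s : Finset β}
    (hs : μ.support ⊆ s) : expectation μ h = ∑ b ∈ s, (μ b).toReal * h b := by
  refine tsum_eq_sum fun b hb => ?_
  have : μ b = 0 := by
    by_contra h0
    exact hb (hs ((PMF.mem_support_iff _ _).2 h0))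
  simp [this]

/-- Finite branching turns all series into finite sums that can be interchanged, so no summability
of `h` is needed. From here on, expectations are computed by recursion on the algorithm. -/
theorem Ensures.expectation_eq {P : Out → Prop} (h : Out → ℝ) {alg : AdaptiveAlg Q A Out} :
    ∀ {r : ℕ}, alg.Ensures oracle N P r →
      expectation (alg.run oracle) h = alg.expect oracle h := by
  induction alg with
  | output o =>
    intro r _
    classical
    rw [run, expectation_eq_sum _ _ (s := {o}) (by rw [PMF.support_pure]; simp)]
    simp [expect]
  | random μ next ih =>
    intro r he
    have hfin := Ensures.support_finite (alg := random μ next) he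
    have hμ : μ.support ⊆ (he.1.toFinset : Set ℕ) := by simp
    have hsupp : ((random μ next).run oracle).support ⊆ (hfin.toFinset : Set Out) := by simp
    rw [expectation_eq_sum _ _ hsupp]
    have h1 : (random μ next).expect oracle h =
        ∑ k ∈ he.1.toFinset, (μ k).toReal * (next k).expect oracle h :=
      expectation_eq_sum μ (fun k => (next k).expect oracle h) hμ
    have h2 : ∀ k ∈ he.1.toFinset, (μ k).toReal * (next k).expect oracle h =
        ∑ b ∈ hfin.toFinset, (μ k).toReal * ((((next k).run oracle) b).toReal * h b) := by
      intro k hk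
      have hk' : k ∈ μ.support := by simpa using hk
      rw [← ih k (he.2 k hk'), expectation_eq_sum _ _ (s := hfin.toFinset), Finset.mul_sum]
      intro b hb
      rw [Set.Finite.coe_toFinset, run, PMF.mem_support_bind_iff]
      exact ⟨k, hk', hb⟩
    rw [h1, Finset.sum_congr rfl h2, Finset.sum_comm]
    refine Finset.sum_congr rfl fun b _ => ?_
    have h3 : ((random μ next).run oracle) b =
        ∑ k ∈ he.1.toFinset, μ k * ((next k).run oracle) b := by
      rw [run, PMF.bind_apply]
      refine tsum_eq_sum fun k hk => ?_
      have : μ k = 0 := by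
        by_contra h0
        exact hk (by simpa using h0)
      simp [this]
    rw [h3, ENNReal.toReal_sum, Finset.sum_mul]
    · refine Finset.sum_congr rfl fun k _ => ?_
      rw [ENNReal.toReal_mul, mul_assoc]
    · exact fun k _ => ENNReal.mul_ne_top (PMF.apply_ne_top _ _) (PMF.apply_ne_top _ _)
  | round qs next ih => intro r he; exact ih _ he.2.2

end

/-! ### Uniform draws and parallel queries as algorithms. -/

/-- Draw a uniformly random element of a finite type. -/
noncomputable def uniform (Q A : Type*) (T : Type*) [Fintype T] [Nonempty T] :
    AdaptiveAlg Q A T :=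
  random ((PMF.uniformOfFintype T).map fun t => (Fintype.equivFin T t : ℕ)) fun k =>
    output (Function.invFun (fun t => (Fintype.equivFin T t : ℕ)) k)

theorem ensures_uniform {Q A T : Type*} [Fintype T] [Nonempty T] (oracle : Q → A) (N : ℝ) :
    (uniform Q A T).Ensures oracle N (fun _ => True) 0 := by
  refine ⟨?_, fun _ _ => trivial⟩
  rw [PMF.support_map]
  exact Set.toFinite _

theorem expect_uniform {Q A T : Type*} [Fintype T] [Nonempty T] (oracle : Q → A) (h : T → ℝ) :
    (uniform Q A T).expect oracle h = 𝔼 t, h t := by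
  classical
  set e : T → ℕ := fun t => (Fintype.equivFin T t : ℕ) with he
  have hinj : Function.Injective e := fun a b hab =>
    (Fintype.equivFin T).injective (Fin.ext hab)
  have h1 : (uniform Q A T).expect oracle h =
      ∑ k ∈ Finset.univ.map ⟨e, hinj⟩,
        ((PMF.uniformOfFintype T).map e k).toReal * h (Function.invFun e k) := by
    refine expectation_eq_sum _ (fun k => h (Function.invFun e k)) ?_
    rw [PMF.support_map]
    simp [he]
  rw [h1, Finset.sum_map, Finset.expect_eq_sum_div_card, Finset.sum_div]
  refine Finset.sum_congr rfl fun t _ => ?_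
  have h2 : (PMF.uniformOfFintype T).map e (e t) = (Fintype.card T : ENNReal)⁻¹ := by
    rw [PMF.map_apply, tsum_eq_single t]
    · simp
    · intro t' ht'
      rw [if_neg fun h => ht' (hinj h).symm]
  simp only [Function.Embedding.coeFn_mk]
  rw [h2, Function.leftInverse_invFun hinj t]
  simp [div_eq_inv_mul]

open Classical in
/-- Ask all queries of `qs` in one round; the result is the table of answers, extended by `0`. -/
noncomputable def ask {Q : Type*} (qs : Finset Q) : AdaptiveAlg Q ℝ (Q → ℝ) :=
  round qs fun a => output fun q => if hq : q ∈ qs then a ⟨q, hq⟩ else 0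

theorem ensures_ask {Q : Type*} (oracle : Q → ℝ) (qs : Finset Q) {N : ℝ} (hN : (qs.card : ℝ) ≤ N) :
    (ask qs).Ensures oracle N (fun a => ∀ q ∈ qs, a q = oracle q) 1 := by
  refine ⟨hN, one_pos, fun q hq => ?_⟩
  simp [hq]

open Classical in
theorem expect_ask {Q : Type*} (oracle : Q → ℝ) (qs : Finset Q) (h : (Q → ℝ) → ℝ) :
    (ask qs).expect oracle h = h fun q => if q ∈ qs then oracle q else 0 := by
  simp only [ask, expect]
  congr 1

end AdaptiveAlg

/-! ### Uniformly random orderings -/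

section RandomOrder
variable {α : Type*} [DecidableEq α]

/-- Draw a list of `n` elements of `X` one by one, uniformly and without replacement. -/
noncomputable def randomList (Q A : Type*) : ℕ → Finset α → AdaptiveAlg Q A (List α)
  | 0, _ => .output []
  | n + 1, X =>
    if h : X.Nonempty then
      haveI : Nonempty X := h.to_subtype
      (AdaptiveAlg.uniform Q A X).bind fun e =>
        (randomList Q A n (X.erase e)).bind fun l => .output ((e : α) :: l)
    else .output []

/-- The expected value of `h` at a list drawn by `randomList`. -/
noncomputable def listExpect : ℕ → Finset α → (List α → ℝ) → ℝ
  | 0, _, h => h []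
  | n + 1, X, h =>
    if X.Nonempty then 𝔼 e ∈ X, listExpect n (X.erase e) fun l => h (e :: l) else h []

theorem expect_randomList {Q A : Type*} (oracle : Q → A) (n : ℕ) (X : Finset α)
    (h : List α → ℝ) :
    (randomList Q A n X).expect oracle h = listExpect n X h := by
  induction n generalizing X h with
  | zero => rfl
  | succ n ih =>
    rw [randomList, listExpect]
    split_ifs with hX
    · have : Nonempty X := hX.to_subtype
      rw [AdaptiveAlg.expect_bind, AdaptiveAlg.expect_uniform]
      simp only [AdaptiveAlg.expect_bind, ih, AdaptiveAlg.expect]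
      rw [Finset.expect_eq_sum_div_card, Finset.expect_eq_sum_div_card]
      congr 1
      · exact Finset.sum_coe_sort X fun e => listExpect n (X.erase e) fun l => h (e :: l)
      · simp
    · rfl

theorem ensures_randomList {Q A : Type*} (oracle : Q → A) (N : ℝ) (n : ℕ) (X : Finset α) :
    (randomList Q A n X).Ensures oracle N (fun l => l.Nodup ∧ ∀ e ∈ l, e ∈ X) 0 := by
  induction n generalizing X with
  | zero => exact ⟨List.nodup_nil, by simp⟩
  | succ n ih =>
    rw [randomList]
    split_ifs with hX
    · have : Nonempty X := hX.to_subtype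
      refine AdaptiveAlg.Ensures.bind (s := 0) (fun e _ => ?_)
        (AdaptiveAlg.ensures_uniform oracle N)
      refine AdaptiveAlg.Ensures.bind (s := 0) (fun l hl => ?_) (ih (X.erase e))
      refine ⟨List.nodup_cons.2 ⟨fun he => ?_, hl.1⟩, ?_⟩
      · exact Finset.notMem_erase _ _ (hl.2 _ he)
      · intro x hx
        rcases List.mem_cons.1 hx with rfl | hx
        · exact e.2
        · exact Finset.mem_of_mem_erase (hl.2 _ hx)
    · exact ⟨List.nodup_nil, by simp⟩

/-- Because `n` is the size of `X`, every list that is drawn is a complete ordering of `X`, and only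
those lists need to be compared. -/
theorem listExpect_mono {n : ℕ} {X : Finset α} (hn : X.card = n) {h h' : List α → ℝ}
    (hh : ∀ l : List α, l.Nodup → l.toFinset = X → h l ≤ h' l) :
    listExpect n X h ≤ listExpect n X h' := by
  induction n generalizing X h h' with
  | zero =>
    rw [Finset.card_eq_zero] at hn
    exact hh [] List.nodup_nil (by simp [hn])
  | succ n ih =>
    rw [listExpect, listExpect]
    have hX : X.Nonempty := by rw [← Finset.card_pos]; omega
    rw [if_pos hX, if_pos hX]
    refine Finset.expect_le_expect fun e he => ?_
    refine ih (by rw [Finset.card_erase_of_mem he]; omega) fun l hl hlX => ?_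
    refine hh _ (List.nodup_cons.2 ⟨fun h => ?_, hl⟩) ?_
    · rw [← List.mem_toFinset, hlX] at h
      exact Finset.notMem_erase _ _ h
    · rw [List.toFinset_cons, hlX, Finset.insert_erase he]

theorem listExpect_const (n : ℕ) (X : Finset α) (r : ℝ) : listExpect n X (fun _ => r) = r := by
  induction n generalizing X with
  | zero => rfl
  | succ n ih =>
    rw [listExpect]
    split_ifs with hX
    · simp only [ih]
      exact Finset.expect_const hX r
    · rfl

theorem listExpect_add (n : ℕ) (X : Finset α) (h h' : List α → ℝ) :
    listExpect n X (fun l => h l + h' l) = listExpect n X h + listExpect n X h' := by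
  induction n generalizing X h h' with
  | zero => rfl
  | succ n ih =>
    simp only [listExpect]
    split_ifs with hX
    · simp only [ih, Finset.expect_add_distrib]
    · rfl

theorem listExpect_mul (n : ℕ) (X : Finset α) (r : ℝ) (h : List α → ℝ) :
    listExpect n X (fun l => r * h l) = r * listExpect n X h := by
  induction n generalizing X h with
  | zero => rfl
  | succ n ih =>
    simp only [listExpect]
    split_ifs with hX
    · simp only [ih, Finset.mul_expect]
    · rfl

theorem listExpect_expect_comm {T : Type*} [Fintype T] (n : ℕ) (X : Finset α)
    (h : T → List α → ℝ) :
    listExpect n X (fun l => 𝔼 t, h t l) = 𝔼 t, listExpect n X (h t) := by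
  induction n generalizing X h with
  | zero => rfl
  | succ n ih =>
    simp only [listExpect]
    split_ifs with hX
    · simp only [ih]
      exact Finset.expect_comm _ _ _
    · rfl

end RandomOrder

/-! ### Averages of independent samples -/

section Sampling

theorem expect_pi_succ {U : Type*} [Fintype U] (M : ℕ) (h : (Fin (M + 1) → U) → ℝ) :
    𝔼 ω, h ω = 𝔼 u : U, 𝔼 ω : Fin M → U, h (Fin.cons u ω) := by
  have h1 : 𝔼 ω, h ω = 𝔼 x : U × (Fin M → U), h (Fin.cons x.1 x.2) :=
    (Fintype.expect_equiv (Fin.consEquiv fun _ => U) _ _ fun x => rfl).symm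
  rw [h1, ← Finset.univ_product_univ, Finset.expect_product]

/-- Cross terms vanish by independence and mean zero, so variances add. -/
theorem expect_sum_sq {U : Type*} [Fintype U] [Nonempty U] (h : U → ℝ) (h0 : 𝔼 u, h u = 0)
    (M : ℕ) :
    𝔼 ω : Fin M → U, (∑ k, h (ω k)) ^ 2 = M * 𝔼 u, h u ^ 2 := by
  induction M with
  | zero => simp
  | succ M ih =>
    rw [expect_pi_succ]
    simp only [Fin.sum_univ_succ, Fin.cons_zero, Fin.cons_succ, add_sq, Finset.expect_add_distrib,
      ih, ← Finset.mul_expect, ← Finset.expect_mul, h0, Fintype.expect_const]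
    push_cast
    ring

/-- The mean absolute error of an average of `M` independent samples. -/
theorem expect_abs_sampleMean_sub_le {U : Type*} [Fintype U] [Nonempty U] (h : U → ℝ) {B : ℝ}
    (hB : ∀ u, h u ∈ Set.Icc 0 B) {M : ℕ} (hM : 0 < M) :
    𝔼 ω : Fin M → U, |(𝔼 k, h (ω k)) - 𝔼 u, h u| ≤ B / Real.sqrt M := by
  have : Nonempty (Fin M) := ⟨⟨0, hM⟩⟩
  have hM' : (0 : ℝ) < M := by exact_mod_cast hM
  set μ := 𝔼 u, h u with hμ
  have hB0 : 0 ≤ B := (hB (Classical.arbitrary U)).1.trans (hB (Classical.arbitrary U)).2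
  have hμ0 : 0 ≤ μ := Finset.expect_nonneg fun u _ => (hB u).1
  have hμB : μ ≤ B := by
    have := Finset.expect_le_expect (s := Finset.univ) (f := h) (g := fun _ => B)
      fun u _ => (hB u).2
    rwa [Fintype.expect_const] at this
  have hc : 𝔼 u, (h u - μ) = 0 := by
    rw [Finset.expect_sub_distrib, Fintype.expect_const, ← hμ, sub_self]
  have hsq : 𝔼 u, (h u - μ) ^ 2 ≤ B ^ 2 := by
    have := Finset.expect_le_expect (s := Finset.univ) (f := fun u => (h u - μ) ^ 2)
      (g := fun _ => B ^ 2) fun u _ => by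
        have h1 := (hB u).1
        have h2 := (hB u).2
        exact sq_le_sq' (by linarith) (by linarith)
    rwa [Fintype.expect_const] at this
  have hvar : 𝔼 ω : Fin M → U, ((𝔼 k, h (ω k)) - μ) ^ 2 ≤ B ^ 2 / M := by
    have h1 : ∀ ω : Fin M → U, ((𝔼 k, h (ω k)) - μ) ^ 2 =
        (1 / (M : ℝ) ^ 2) * (∑ k, (h (ω k) - μ)) ^ 2 := by
      intro ω
      rw [Finset.expect_eq_sum_div_card, Finset.sum_sub_distrib]
      simp only [Finset.sum_const, Finset.card_univ, Fintype.card_fin, nsmul_eq_mul]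
      field_simp
    simp only [h1]
    rw [← Finset.mul_expect, expect_sum_sq _ hc]
    calc 1 / (M : ℝ) ^ 2 * (M * 𝔼 u, (h u - μ) ^ 2) = (𝔼 u, (h u - μ) ^ 2) / M := by field_simp
      _ ≤ B ^ 2 / M := by gcongr
  -- The variance of the absolute error is nonnegative.
  have hjensen : (𝔼 ω : Fin M → U, |(𝔼 k, h (ω k)) - μ|) ^ 2 ≤
      𝔼 ω : Fin M → U, ((𝔼 k, h (ω k)) - μ) ^ 2 := by
    set a := 𝔼 ω : Fin M → U, |(𝔼 k, h (ω k)) - μ| with ha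
    have h1 : 0 ≤ 𝔼 ω : Fin M → U, (|(𝔼 k, h (ω k)) - μ| - a) ^ 2 :=
      Finset.expect_nonneg fun _ _ => sq_nonneg _
    simp only [sub_sq, sq_abs, Finset.expect_add_distrib, Finset.expect_sub_distrib,
      ← Finset.mul_expect, ← Finset.expect_mul, Fintype.expect_const, ← ha] at h1
    simp only [sub_sq, Finset.expect_add_distrib, Finset.expect_sub_distrib,
      ← Finset.mul_expect, ← Finset.expect_mul, Fintype.expect_const]
    nlinarith
  have h2 := hjensen.trans hvar
  refine le_of_sq_le_sq ?_ (by positivity)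
  rwa [div_pow, Real.sq_sqrt hM'.le]

end Sampling

/-! ### Blocked elements of a matchoid -/

section Blocked
variable {α ι : Type*}

/-- The element `e` lies in `T`, or it is spanned by `T` in a matroid in which it participates. -/
def Matchoid.Blocked (M : Matchoid α ι) (T : Finset α) (e : α) : Prop :=
  e ∈ T ∨ ∃ i, e ∈ M.groundSet i ∧ e ∈ (M.matroid i).closure (T : Set α)

/-- Being blocked, in terms of the answers to rank queries. -/
def BlockedBy [DecidableEq α] (G : ι → Set α) (ans : MatchoidQuery α ι → ℝ) (T : Finset α)
    (e : α) : Prop :=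
  e ∈ T ∨ ∃ i, e ∈ G i ∧ ans (.rank i (insert e T)) = ans (.rank i T)

/-- Outside the closure the rank grows by one; finiteness of `T` excludes rank `⊤`, for which adding
one would change nothing. -/
theorem Matroid.eRk_insert_eq_iff {N : Matroid α} {e : α} {T : Set α} (hT : T.Finite)
    (he : e ∈ N.E) : N.eRk (insert e T) = N.eRk T ↔ e ∈ N.closure T := by
  constructor
  · intro h
    by_contra hcl
    rw [Matroid.eRk_insert_eq_add_one ⟨he, hcl⟩] at h
    have hfin : N.eRk T ≠ ⊤ :=
      ne_top_of_le_ne_top (Set.encard_ne_top_iff.2 hT) (N.eRk_le_encard T)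
    obtain ⟨k, hk⟩ := ENat.ne_top_iff_exists.1 hfin
    rw [← hk] at h
    have : k + 1 = k := by exact_mod_cast h
    omega
  · intro h
    rw [← N.eRk_closure_eq (insert e T), ← N.eRk_closure_eq T]
    congr 1
    exact N.closure_insert_eq_of_mem_closure h

theorem blockedBy_oracle_iff [DecidableEq α] {M : Matchoid α ι} {f : Finset α → ℝ}
    {G : ι → Set α} (hG : M.groundSet = G) (T : Finset α) (e : α) :
    BlockedBy G (matchoidOracle M f) T e ↔ M.Blocked T e := by
  subst hG
  refine or_congr_right (exists_congr fun i => and_congr_right fun he => ?_)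
  have hT : (T : Set α).Finite := T.finite_toSet
  rw [← Matroid.eRk_insert_eq_iff hT he]
  simp only [matchoidOracle, Nat.cast_inj, Finset.coe_insert]
  constructor
  · intro h
    have h' := congrArg (Nat.cast : ℕ → ℕ∞) h
    rwa [ENat.natCast_toNat, ENat.natCast_toNat] at h'
    · exact ne_top_of_le_ne_top (Set.encard_ne_top_iff.2 hT) (Matroid.eRk_le_encard _ _)
    · exact ne_top_of_le_ne_top (Set.encard_ne_top_iff.2 (hT.insert e)) (Matroid.eRk_le_encard _ _)
  · intro h
    rw [h]

theorem Matchoid.Blocked.mono {M : Matchoid α ι} {T T' : Finset α} (h : T ⊆ T') {e : α}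
    (he : M.Blocked T e) : M.Blocked T' e := by
  rcases he with he | ⟨i, hi, he⟩
  · exact Or.inl (h he)
  · exact Or.inr ⟨i, hi, (M.matroid i).closure_subset_closure (by exact_mod_cast h) he⟩

theorem Matchoid.Indep.subset {M : Matchoid α ι} {S T : Finset α} (hT : M.Indep T) (h : S ⊆ T) :
    M.Indep S := fun i =>
  (hT i).subset (Set.inter_subset_inter_left _ (by exact_mod_cast h))

/-- Closures are monotone, so testing against the larger set of sampled elements is a safe test for
the accepted ones. -/
theorem Matchoid.Indep.insert [DecidableEq α] {M : Matchoid α ι} {S T : Finset α} {e : α}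
    (hS : M.Indep S) (hST : S ⊆ T) (he : ¬ M.Blocked T e) : M.Indep (insert e S) := by
  intro i
  have he' : ¬ M.Blocked S e := fun h => he (h.mono hST)
  by_cases hi : e ∈ M.groundSet i
  · rw [Finset.coe_insert, Set.insert_inter_of_mem hi, Matroid.Indep.insert_indep_iff (hS i)]
    refine Or.inl ⟨hi, fun hcl => he' (Or.inr ⟨i, hi, ?_⟩)⟩
    exact (M.matroid i).closure_subset_closure Set.inter_subset_left hcl
  · rw [Finset.coe_insert, Set.insert_inter_of_notMem hi]
    exact hS i

theorem Matchoid.indep_singleton [DecidableEq α] {M : Matchoid α ι} {e : α}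
    (he : ¬ M.Blocked ∅ e) : M.Indep {e} := by
  simpa using M.indep_empty.insert subset_rfl he

open Classical in
-- In the `i`-th matroid, the elements of `O` spanned by `Q` are independent, so there are at most
-- as many as the rank of `Q`, which is at most the number of elements of `Q` in that ground set.
-- Summing over `i` counts each element of `Q` at most `p` times. An element of `Q` in no ground set
-- can block only itself; this is where `1 ≤ p` enters.
theorem Matchoid.card_blocked_le [Fintype ι] {M : Matchoid α ι} {p : ℕ} (hp : 1 ≤ p)
    (hM : M.IsPMatchoid p) {O : Finset α} (hO : M.Indep O) (Q : Finset α) :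
    (O.filter (M.Blocked Q)).card ≤ p * Q.card := by
  have hsub : O.filter (M.Blocked Q) ⊆ Q.filter (fun e => ∀ i, e ∉ M.groundSet i) ∪
      Finset.univ.biUnion fun i =>
        O.filter fun e => e ∈ M.groundSet i ∧ e ∈ (M.matroid i).closure (Q : Set α) := by
    intro e he
    rw [Finset.mem_filter] at he
    rw [Finset.mem_union, Finset.mem_filter, Finset.mem_biUnion]
    rcases he.2 with hQ | ⟨i, hi, hcl⟩
    · by_cases h : ∀ i, e ∉ M.groundSet i
      · exact Or.inl ⟨hQ, h⟩
      · push Not at h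
        obtain ⟨i, hi⟩ := h
        refine Or.inr ⟨i, Finset.mem_univ _, Finset.mem_filter.2 ⟨he.1, hi, ?_⟩⟩
        exact (M.matroid i).mem_closure_of_mem' (by exact_mod_cast hQ) hi
    · exact Or.inr ⟨i, Finset.mem_univ _, Finset.mem_filter.2 ⟨he.1, hi, hcl⟩⟩
  have hi : ∀ i, (O.filter fun e => e ∈ M.groundSet i ∧
      e ∈ (M.matroid i).closure (Q : Set α)).card ≤
        (Q.filter fun e => e ∈ M.groundSet i).card := by
    intro i
    have hind : (M.matroid i).Indep ((O.filter fun e => e ∈ M.groundSet i ∧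
        e ∈ (M.matroid i).closure (Q : Set α) : Finset α) : Set α) := by
      refine (hO i).subset fun e he => ?_
      have he := (Finset.mem_filter.1 (Finset.mem_coe.1 he))
      exact ⟨he.1, he.2.1⟩
    have h1 := hind.encard_le_eRk_of_subset (X := (M.matroid i).closure (Q : Set α))
      fun e he => (Finset.mem_filter.1 (Finset.mem_coe.1 he)).2.2
    rw [Matroid.eRk_closure_eq, ← Matroid.eRk_inter_ground] at h1
    have h2 := h1.trans (Matroid.eRk_le_encard _ _)
    have h3 : (Q : Set α) ∩ (M.matroid i).E =
        ((Q.filter fun e => e ∈ M.groundSet i : Finset α) : Set α) := by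
      rw [Finset.coe_filter]
      rfl
    rw [h3, Set.encard_coe_eq_coe_finsetCard, Set.encard_coe_eq_coe_finsetCard] at h2
    exact_mod_cast h2
  have hcount : ∀ q ∈ Q, (if ∀ i, q ∉ M.groundSet i then 1 else 0) +
      (Finset.univ.filter fun i => q ∈ M.groundSet i).card ≤ p := by
    intro q _
    have h1 : (Finset.univ.filter fun i => q ∈ M.groundSet i).card ≤ p := by
      have := hM q
      rw [show {i | q ∈ M.groundSet i} =
        ((Finset.univ.filter fun i => q ∈ M.groundSet i : Finset ι) : Set ι) by ext; simp,
        Set.encard_coe_eq_coe_finsetCard] at this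
      exact_mod_cast this
    split_ifs with h
    · rw [Finset.filter_false_of_mem fun i _ => h i]
      simpa using hp
    · simpa using h1
  calc (O.filter (M.Blocked Q)).card
      ≤ (Q.filter (fun e => ∀ i, e ∉ M.groundSet i)).card +
        ∑ i, (O.filter fun e => e ∈ M.groundSet i ∧
          e ∈ (M.matroid i).closure (Q : Set α)).card :=
        (Finset.card_le_card hsub).trans ((Finset.card_union_le _ _).trans
          (Nat.add_le_add_left Finset.card_biUnion_le _))
    _ ≤ (Q.filter (fun e => ∀ i, e ∉ M.groundSet i)).card +
        ∑ i, (Q.filter fun e => e ∈ M.groundSet i).card :=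
        Nat.add_le_add_left (Finset.sum_le_sum fun i _ => hi i) _
    _ = ∑ q ∈ Q, ((if ∀ i, q ∉ M.groundSet i then 1 else 0) +
        (Finset.univ.filter fun i => q ∈ M.groundSet i).card) := by
        rw [Finset.sum_add_distrib]
        simp only [Finset.card_filter]
        rw [Finset.sum_comm]
    _ ≤ ∑ _q ∈ Q, p := Finset.sum_le_sum hcount
    _ = p * Q.card := by rw [Finset.sum_const, smul_eq_mul, mul_comm]

end Blocked

/-! ### The multilinear extension on a grid -/

section Grid
variable {α : Type*} [Fintype α] [DecidableEq α]

/-- If `u` is uniform, then this set contains each `e` independently with probability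
`min (c e / K) 1`. -/
def sampleSet {K : ℕ} (c : α → ℕ) (u : α → Fin K) : Finset α :=
  Finset.univ.filter fun e => (u e : ℕ) < c e

/-- The multilinear extension of `f` at the point `c / K`. -/
noncomputable def gridValue (f : Finset α → ℝ) (K : ℕ) (c : α → ℕ) : ℝ :=
  𝔼 u : α → Fin K, f (sampleSet c u)

/-- The increase of `v` at a sample from switching the element `e` on. -/
def sampleGain (v : Finset α → ℝ) {K : ℕ} (c : α → ℕ) (e : α) (u : α → Fin K) : ℝ :=
  v (insert e (sampleSet c u)) - v ((sampleSet c u).erase e)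

/-- The partial derivative with respect to `e` of the multilinear extension at `c / K`. -/
noncomputable def meanGain (f : Finset α → ℝ) (K : ℕ) (c : α → ℕ) (e : α) : ℝ :=
  𝔼 u : α → Fin K, sampleGain f c e u

omit [DecidableEq α] in
theorem mem_sampleSet {K : ℕ} {c : α → ℕ} {u : α → Fin K} {e : α} :
    e ∈ sampleSet c u ↔ (u e : ℕ) < c e := by
  simp [sampleSet]

/-- A coordinate uniform on `Fin K` lies below `c e` with probability `min (c e / K) 1`, and the
coordinates are independent. At grid points, exact inclusion probabilities thus come from uniform
draws. -/
theorem multilinearExtension_grid (f : Finset α → ℝ) {K : ℕ} (hK : 0 < K) (c : α → ℕ) :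
    multilinearExtension f (fun e => (c e : ℝ) / K) = gridValue f K c := by
  have hK' : (0 : ℝ) < K := by exact_mod_cast hK
  have hcard : ∀ e, ((Finset.univ.filter fun j : Fin K => (j : ℕ) < c e).card : ℝ) =
      min ((c e : ℝ) / K) 1 * K := by
    intro e
    have h1 : (Finset.univ.filter fun j : Fin K => (j : ℕ) < c e).card = min (c e) K := by
      rw [Fin.card_filter_val_lt, min_comm]
    rw [h1, Nat.cast_min, min_mul_of_nonneg _ _ hK'.le]
    field_simp
  have hcard' : ∀ e, ((Finset.univ.filter fun j : Fin K => ¬ (j : ℕ) < c e).card : ℝ) =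
      (1 - min ((c e : ℝ) / K) 1) * K := by
    intro e
    have h1 := Finset.card_filter_add_card_filter_not (s := (Finset.univ : Finset (Fin K)))
      (fun j : Fin K => (j : ℕ) < c e)
    rw [Finset.card_univ, Fintype.card_fin] at h1
    have h2 : ((Finset.univ.filter fun j : Fin K => (j : ℕ) < c e).card : ℝ) +
      ((Finset.univ.filter fun j : Fin K => ¬ (j : ℕ) < c e).card : ℝ) = K := by exact_mod_cast h1
    rw [hcard] at h2
    linarith
  have hfib : ∀ S : Finset α,
      ((Finset.univ.filter fun u : α → Fin K => sampleSet c u = S).card : ℝ) =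
        (∏ e ∈ S, min ((c e : ℝ) / K) 1) * (∏ e ∈ Sᶜ, (1 - min ((c e : ℝ) / K) 1)) *
          (K : ℝ) ^ Fintype.card α := by
    intro S
    have h1 : (Finset.univ.filter fun u : α → Fin K => sampleSet c u = S) =
        Fintype.piFinset fun e => if e ∈ S then Finset.univ.filter fun j : Fin K => (j : ℕ) < c e
          else Finset.univ.filter fun j : Fin K => ¬ (j : ℕ) < c e := by
      ext u
      rw [Finset.mem_filter, Fintype.mem_piFinset, Finset.ext_iff]
      simp only [Finset.mem_univ, true_and, mem_sampleSet]
      refine forall_congr' fun e => ?_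
      split_ifs with h <;> simp [h]
    rw [h1, Fintype.card_piFinset, Nat.cast_prod, ← Finset.prod_mul_prod_compl S]
    rw [Finset.prod_congr rfl fun e he => by rw [if_pos he, hcard],
      Finset.prod_congr (s₁ := Sᶜ) rfl fun e he => by
        rw [if_neg (Finset.mem_compl.1 he), hcard']]
    rw [Finset.prod_mul_distrib, Finset.prod_mul_distrib, Finset.prod_const, Finset.prod_const]
    have : (K : ℝ) ^ Fintype.card α = (K : ℝ) ^ S.card * (K : ℝ) ^ Sᶜ.card := by
      rw [← pow_add, Finset.card_add_card_compl]
    rw [this]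
    ring
  have hsum : ∑ u : α → Fin K, f (sampleSet c u) =
      ∑ S : Finset α, ((Finset.univ.filter fun u : α → Fin K => sampleSet c u = S).card : ℝ) *
        f S := by
    rw [← Finset.sum_fiberwise (s := Finset.univ) (g := fun u : α → Fin K => sampleSet c u)]
    refine Finset.sum_congr rfl fun S _ => ?_
    rw [Finset.sum_congr rfl fun u hu => by rw [(Finset.mem_filter.1 hu).2], Finset.sum_const,
      nsmul_eq_mul]
  rw [gridValue, Finset.expect_eq_sum_div_card, hsum, multilinearExtension, Finset.sum_div]
  refine Finset.sum_congr rfl fun S _ => ?_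
  rw [hfib]
  simp only [Finset.card_univ, Fintype.card_pi, Fintype.card_fin, Finset.prod_const]
  push_cast
  field_simp

/-- Resampling one coordinate of a uniform vector leaves it uniform. -/
theorem expect_update {K : ℕ} (e : α) (h : (α → Fin K) → ℝ) :
    𝔼 u, h u = 𝔼 u, 𝔼 j, h (Function.update u e j) := by
  set E := Equiv.funSplitAt e (Fin K) with hE
  have h1 : ∀ h' : (α → Fin K) → ℝ, 𝔼 u, h' u = 𝔼 j, 𝔼 w, h' (E.symm (j, w)) := by
    intro h'
    rw [← Fintype.expect_equiv E.symm (fun x => h' (E.symm x)) h' fun _ => rfl,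
      ← Finset.univ_product_univ, Finset.expect_product]
  have h2 : ∀ j j' w, Function.update (E.symm (j', w)) e j = E.symm (j, w) := by
    intro j j' w
    ext x
    by_cases hx : x = e
    · subst hx; simp [hE, Equiv.funSplitAt]
    · simp [hE, Equiv.funSplitAt, hx]
  rw [h1, h1 fun u => 𝔼 j, h (Function.update u e j)]
  simp only [h2]
  rcases isEmpty_or_nonempty (Fin K) with hK | hK
  · simp
  · rw [Fintype.expect_const, Finset.expect_comm]

/-- Raising `c e` by one alters the sample only if the coordinate `u e` equals the old `c e`. This
has probability `1 / K`, and then `e` is switched on. The increment is an exact partial derivative,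
without discretization error. -/
theorem gridValue_update_sub (f : Finset α → ℝ) {K : ℕ} (c : α → ℕ) {e : α} (he : c e < K) :
    K * (gridValue f K (Function.update c e (c e + 1)) - gridValue f K c) = meanGain f K c e := by
  have hK : (K : ℝ) ≠ 0 := by
    have : 0 < K := by omega
    positivity
  rw [gridValue, gridValue, ← Finset.expect_sub_distrib, expect_update e, Finset.mul_expect,
    meanGain]
  refine Finset.expect_congr rfl fun u _ => ?_
  have h1 : ∀ j : Fin K, f (sampleSet (Function.update c e (c e + 1)) (Function.update u e j)) -
      f (sampleSet c (Function.update u e j)) =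
        if j = ⟨c e, he⟩ then sampleGain f c e u else 0 := by
    intro j
    split_ifs with hj
    · rw [sampleGain]
      congr 2 <;>
      · ext x
        by_cases hx : x = e
        · subst hx; simp [mem_sampleSet, hj]
        · simp [mem_sampleSet, hx]
    · rw [sub_eq_zero]
      congr 1
      ext x
      by_cases hx : x = e
      · subst hx
        have : (j : ℕ) ≠ c x := fun h => hj (Fin.ext h)
        simp only [mem_sampleSet, Function.update_self]
        omega
      · simp [mem_sampleSet, hx]
  simp only [h1]
  rw [Finset.expect_eq_sum_div_card]
  simp
  field_simp

omit [Fintype α] in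
theorem insert_erase_self (S : Finset α) (e : α) : insert e (S.erase e) = insert e S := by
  ext x
  by_cases hx : x = e <;> simp [hx]

omit [Fintype α] in
theorem IsMonotoneSubmodular.insert_sub_le {f : Finset α → ℝ} (hf : IsMonotoneSubmodular f)
    {S T : Finset α} {e : α} (h : S ⊆ T) (he : e ∉ T) :
    f (insert e T) - f T ≤ f (insert e S) - f S := by
  have h1 := hf.submodular (insert e S) T
  have h2 : insert e S ∪ T = insert e T := by
    rw [Finset.insert_union, Finset.union_eq_right.2 h]
  have h3 : insert e S ∩ T = S := by
    rw [Finset.insert_inter_of_notMem he, Finset.inter_eq_left.2 h]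
  rw [h2, h3] at h1
  linarith

theorem sampleGain_anti {f : Finset α → ℝ} (hf : IsMonotoneSubmodular f) {K : ℕ} {c c' : α → ℕ}
    (h : c ≤ c') (e : α) (u : α → Fin K) : sampleGain f c' e u ≤ sampleGain f c e u := by
  have hsub : (sampleSet c u).erase e ⊆ (sampleSet c' u).erase e := by
    refine Finset.erase_subset_erase _ fun x hx => ?_
    rw [mem_sampleSet] at hx ⊢
    exact hx.trans_le (h x)
  have := hf.insert_sub_le hsub (Finset.notMem_erase e _)
  rwa [insert_erase_self, insert_erase_self] at this

theorem sampleGain_nonneg {f : Finset α → ℝ} (hf : IsMonotoneSubmodular f) {K : ℕ} (c : α → ℕ)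
    (e : α) (u : α → Fin K) : 0 ≤ sampleGain f c e u :=
  sub_nonneg.2 (hf.monotone _ _ ((Finset.erase_subset _ _).trans (Finset.subset_insert _ _)))

theorem sampleGain_le {f : Finset α → ℝ} (hf : IsMonotoneSubmodular f) {K : ℕ} (c : α → ℕ)
    (e : α) (u : α → Fin K) : sampleGain f c e u ≤ f {e} := by
  have := hf.insert_sub_le (Finset.empty_subset ((sampleSet c u).erase e))
    (Finset.notMem_erase e _)
  rw [insert_erase_self, hf.normalized, sub_zero] at this
  simpa [sampleGain] using this

theorem meanGain_anti {f : Finset α → ℝ} (hf : IsMonotoneSubmodular f) (K : ℕ) {c c' : α → ℕ}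
    (h : c ≤ c') (e : α) : meanGain f K c' e ≤ meanGain f K c e :=
  Finset.expect_le_expect fun u _ => sampleGain_anti hf h e u

theorem meanGain_le {f : Finset α → ℝ} (hf : IsMonotoneSubmodular f) {K : ℕ} (hK : 0 < K)
    (c : α → ℕ) (e : α) : meanGain f K c e ≤ f {e} := by
  have : Nonempty (Fin K) := ⟨⟨0, hK⟩⟩
  have h := Finset.expect_le_expect (s := Finset.univ) (f := fun u : α → Fin K =>
    sampleGain f c e u) (g := fun _ => f {e}) fun u _ => sampleGain_le hf c e u
  rwa [Fintype.expect_const] at h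

omit [Fintype α] in
theorem IsMonotoneSubmodular.union_sub_le {f : Finset α → ℝ} (hf : IsMonotoneSubmodular f)
    (S O : Finset α) : f (S ∪ O) - f S ≤ ∑ o ∈ O, (f (insert o S) - f S) := by
  induction O using Finset.induction_on with
  | empty => simp
  | insert o O ho ih =>
    rw [Finset.sum_insert ho, Finset.union_insert]
    by_cases h : o ∈ S ∪ O
    · rw [Finset.insert_eq_of_mem h]
      have := hf.monotone S (insert o S) (Finset.subset_insert _ _)
      linarith
    · have := hf.insert_sub_le (Finset.subset_union_left (s₁ := S) (s₂ := O)) h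
      linarith

/-- The standard submodular bound of `f O` by marginal gains holds for every single sample, and is
then averaged. -/
theorem le_gridValue_add_sum_meanGain {f : Finset α → ℝ} (hf : IsMonotoneSubmodular f) {K : ℕ}
    (hK : 0 < K) (c : α → ℕ) (O : Finset α) :
    f O ≤ gridValue f K c + ∑ o ∈ O, meanGain f K c o := by
  have : Nonempty (Fin K) := ⟨⟨0, hK⟩⟩
  have h1 : gridValue f K c + ∑ o ∈ O, meanGain f K c o =
      𝔼 u : α → Fin K, (f (sampleSet c u) + ∑ o ∈ O, sampleGain f c o u) := by
    rw [Finset.expect_add_distrib, Finset.expect_sum_comm]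
    rfl
  have h2 := Finset.expect_le_expect (s := Finset.univ) (f := fun _ : α → Fin K => f O)
    (g := fun u => f (sampleSet c u) + ∑ o ∈ O, sampleGain f c o u) fun u _ => by
      have h3 := hf.union_sub_le (sampleSet c u) O
      have h4 := hf.monotone O (sampleSet c u ∪ O) Finset.subset_union_right
      have h5 : ∑ o ∈ O, (f (insert o (sampleSet c u)) - f (sampleSet c u)) ≤
          ∑ o ∈ O, sampleGain f c o u := by
        refine Finset.sum_le_sum fun o _ => ?_
        have := hf.monotone _ _ (Finset.erase_subset o (sampleSet c u))
        rw [sampleGain]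
        linarith
      linarith
  rwa [Fintype.expect_const, ← h1] at h2

theorem gridValue_zero {f : Finset α → ℝ} (hf : IsMonotoneSubmodular f) (K : ℕ) :
    gridValue f K 0 = 0 := by
  have h : ∀ u : α → Fin K, sampleSet (0 : α → ℕ) u = ∅ := fun u => by
    ext x
    simp [mem_sampleSet]
  simp [gridValue, h, hf.normalized]

end Grid

/-! ### Walking along a list of candidates -/

section Walk
variable {α : Type*} [DecidableEq α]

open Classical in
/-- Sample the elements of a list one by one until at most a `(1 - δ)`-fraction of the candidates
`X` is good. The first component collects all sampled elements, the second one those that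
are good when they are sampled. -/
noncomputable def walk (good : Finset α → α → Prop) (X : Finset α) (δ : ℝ) :
    List α → Finset α → Finset α → Finset α × Finset α
  | [], Q, S => (Q, S)
  | e :: l, Q, S =>
    if ((X.filter (good Q)).card : ℝ) ≤ (1 - δ) * X.card then (Q, S)
    else walk good X δ l (insert e Q) (if good Q e then insert e S else S)

/-- The sets obtained from `Q` by adding the elements of a prefix of a list. -/
def prefixes : List α → Finset α → Finset (Finset α)
  | [], Q => {Q}
  | e :: l, Q => insert Q (prefixes l (insert e Q))

theorem self_mem_prefixes (l : List α) (Q : Finset α) : Q ∈ prefixes l Q := by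
  cases l <;> simp [prefixes]

theorem card_prefixes_le (l : List α) (Q : Finset α) : (prefixes l Q).card ≤ l.length + 1 := by
  induction l generalizing Q with
  | nil => simp [prefixes]
  | cons e l ih => exact (Finset.card_insert_le _ _).trans (Nat.succ_le_succ (ih _))

theorem subset_of_mem_prefixes {l : List α} {Q T : Finset α} (hT : T ∈ prefixes l Q) : Q ⊆ T := by
  induction l generalizing Q with
  | nil => rw [prefixes, Finset.mem_singleton] at hT; rw [hT]
  | cons e l ih =>
    rw [prefixes, Finset.mem_insert] at hT
    rcases hT with rfl | hT
    · exact subset_rfl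
    · exact (Finset.subset_insert _ _).trans (ih hT)

variable {good : Finset α → α → Prop} {X : Finset α} {δ : ℝ}

open Classical in
theorem walk_induct {P : Finset α → Finset α → Prop} {l : List α} {Q S : Finset α}
    (hl : l.Nodup) (hlQ : ∀ e ∈ l, e ∉ Q)
    (hP : ∀ T S' e, T ∈ prefixes l Q → e ∈ l → e ∉ T → P T S' →
      P (insert e T) (if good T e then insert e S' else S')) (h0 : P Q S) :
    (walk good X δ l Q S).1 ∈ prefixes l Q ∧
      P (walk good X δ l Q S).1 (walk good X δ l Q S).2 := by
  induction l generalizing Q S with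
  | nil => exact ⟨self_mem_prefixes _ _, h0⟩
  | cons e l ih =>
    rw [walk]
    split_ifs with h
    · exact ⟨self_mem_prefixes _ _, h0⟩
    all_goals
      rw [List.nodup_cons] at hl
      have h1 := hP Q S e (self_mem_prefixes _ _) List.mem_cons_self
        (hlQ e List.mem_cons_self) h0
      have h2 := ih (Q := insert e Q) (S := if good Q e then insert e S else S) hl.2
        (fun x hx hx' => ?_) (fun T S' x hT hx hxT hPT =>
          hP T S' x (Finset.mem_insert_of_mem hT) (List.mem_cons_of_mem _ hx) hxT hPT) h1
    · rename_i hg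
      rw [if_pos hg] at h2
      exact ⟨Finset.mem_insert_of_mem h2.1, h2.2⟩
    · rcases Finset.mem_insert.1 hx' with rfl | hx'
      · exact hl.1 hx
      · exact hlQ x (List.mem_cons_of_mem _ hx) hx'
    · rename_i hg
      rw [if_neg hg] at h2
      exact ⟨Finset.mem_insert_of_mem h2.1, h2.2⟩
    · rcases Finset.mem_insert.1 hx' with rfl | hx'
      · exact hl.1 hx
      · exact hlQ x (List.mem_cons_of_mem _ hx) hx'

/-- The walk consults goodness only at prefixes of the list, as rejected elements are added to the
first component too. This is what makes one round per walk possible. -/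
theorem walk_congr {good' : Finset α → α → Prop} {l : List α} {Q S : Finset α}
    (h : ∀ T ∈ prefixes l Q, ∀ e, good T e ↔ good' T e) :
    walk good X δ l Q S = walk good' X δ l Q S ∧
      ∀ e, good (walk good X δ l Q S).1 e ↔ good' (walk good X δ l Q S).1 e := by
  classical
  induction l generalizing Q S with
  | nil => exact ⟨rfl, h Q (self_mem_prefixes _ _)⟩
  | cons e l ih =>
    have hQ := h Q (self_mem_prefixes _ _)
    have hQ' : good Q = good' Q := funext fun x => propext (hQ x)
    rw [walk, walk]
    simp only [hQ']
    split_ifs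
    · exact ⟨rfl, hQ⟩
    all_goals exact ih fun T hT => h T (Finset.mem_insert_of_mem hT)

open Classical in
-- Either the stopping test succeeded, or the list ran out; in the latter case all candidates have
-- been sampled and none is good.
theorem card_filter_good_walk_le (hδ : δ ≤ 1) (hgood : ∀ T e, good T e → e ∉ T) {l : List α}
    {Q S : Finset α} (hX : ∀ e ∈ X, e ∈ Q ∨ e ∈ l) :
    ((X.filter (good (walk good X δ l Q S).1)).card : ℝ) ≤ (1 - δ) * X.card := by
  induction l generalizing Q S with
  | nil =>
    rw [walk, Finset.filter_false_of_mem]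
    · have : (0 : ℝ) ≤ 1 - δ := by linarith
      simp only [Finset.card_empty, Nat.cast_zero]
      positivity
    · intro e he hg
      have := hX e he
      simp only [List.not_mem_nil, or_false] at this
      exact hgood _ _ hg this
  | cons e l ih =>
    rw [walk]
    split_ifs with h
    · exact h
    all_goals
      refine ih fun x hx => ?_
      rcases hX x hx with h | h
      · exact Or.inl (Finset.mem_insert_of_mem h)
      · rcases List.mem_cons.1 h with rfl | h
        · exact Or.inl (Finset.mem_insert_self _ _)
        · exact Or.inr h

/-- In expectation, at least a `(1 - δ)`-fraction of the sampled elements is good. -/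
theorem listExpect_walk_nonneg (hgood : ∀ T e, good T e → e ∉ T) (n : ℕ) {Y Q S : Finset α}
    (hY : Y.card = n) (hYX : Y ⊆ X) (hYQ : ∀ e ∈ Y, e ∉ Q) (hX : ∀ e ∈ X, e ∈ Y ∨ e ∈ Q)
    (hSQ : S ⊆ Q) :
    0 ≤ listExpect n Y fun l =>
      (((walk good X δ l Q S).2.card : ℝ) - S.card) -
        (1 - δ) * (((walk good X δ l Q S).1.card : ℝ) - Q.card) := by
  classical
  induction n generalizing Y Q S with
  | zero => simp [listExpect, walk]
  | succ n ih =>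
    have hne : Y.Nonempty := by rw [← Finset.card_pos]; omega
    have hYpos : (0 : ℝ) < Y.card := by exact_mod_cast Finset.card_pos.2 hne
    rw [listExpect, if_pos hne]
    by_cases h : ((X.filter (good Q)).card : ℝ) ≤ (1 - δ) * X.card
    · refine Finset.expect_nonneg fun e _ => ?_
      simp [walk, h, listExpect_const]
    · have hstep : ∀ e ∈ Y, (if good Q e then 1 else 0) - (1 - δ) ≤
          listExpect n (Y.erase e) fun l =>
            (((walk good X δ (e :: l) Q S).2.card : ℝ) - S.card) -
              (1 - δ) * (((walk good X δ (e :: l) Q S).1.card : ℝ) - Q.card) := by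
        intro e he
        have heQ := hYQ e he
        set S' := if good Q e then insert e S else S with hS'
        have hSQ' : S' ⊆ insert e Q := by
          rw [hS']
          split_ifs
          · exact Finset.insert_subset_insert _ hSQ
          · exact hSQ.trans (Finset.subset_insert _ _)
        have h1 := ih (Y := Y.erase e) (Q := insert e Q) (S := S')
          (by rw [Finset.card_erase_of_mem he]; omega)
          ((Finset.erase_subset _ _).trans hYX)
          (fun x hx hxQ => by
            rcases Finset.mem_insert.1 hxQ with rfl | hxQ
            · exact Finset.notMem_erase _ _ hx
            · exact hYQ x (Finset.mem_of_mem_erase hx) hxQ)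
          (fun x hx => by
            rcases hX x hx with h | h
            · by_cases hxe : x = e
              · exact Or.inr (hxe ▸ Finset.mem_insert_self _ _)
              · exact Or.inl (Finset.mem_erase.2 ⟨hxe, h⟩)
            · exact Or.inr (Finset.mem_insert_of_mem h)) hSQ'
        have hcS : (S'.card : ℝ) = S.card + if good Q e then 1 else 0 := by
          rw [hS']
          split_ifs
          · rw [Finset.card_insert_of_notMem fun h => heQ (hSQ h)]
            push_cast
            rfl
          · simp
        have hcQ : ((insert e Q).card : ℝ) = Q.card + 1 := by
          rw [Finset.card_insert_of_notMem heQ]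
          push_cast
          rfl
        have h2 : (listExpect n (Y.erase e) fun l =>
            (((walk good X δ (e :: l) Q S).2.card : ℝ) - S.card) -
              (1 - δ) * (((walk good X δ (e :: l) Q S).1.card : ℝ) - Q.card)) =
            listExpect n (Y.erase e) fun l =>
              ((((walk good X δ l (insert e Q) S').2.card : ℝ) - S'.card) -
                (1 - δ) * (((walk good X δ l (insert e Q) S').1.card : ℝ) - (insert e Q).card)) +
              ((if good Q e then 1 else 0) - (1 - δ)) := by
          congr 1
          ext l
          rw [walk, if_neg h, ← hS', hcS, hcQ]
          ring
        rw [h2, listExpect_add, listExpect_const]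
        linarith
      refine le_trans ?_ (Finset.expect_le_expect hstep)
      rw [Finset.expect_sub_distrib, Finset.expect_const hne, sub_nonneg,
        Finset.expect_eq_sum_div_card, le_div_iff₀ hYpos]
      push Not at h
      -- Good candidates are still unsampled, hence lie in `Y`. As the walk has not stopped, they
      -- exceed `(1 - δ) * X.card`, which makes their share of `Y` at least `1 - δ`.
      have h3 : (X.filter (good Q)).card ≤ (Y.filter (good Q)).card := by
        refine Finset.card_le_card fun e he => ?_
        rw [Finset.mem_filter] at he ⊢
        exact ⟨(hX e he.1).resolve_right (hgood _ _ he.2), he.2⟩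
      have h4 : Y.card ≤ X.card := Finset.card_le_card hYX
      have h3' : ((X.filter (good Q)).card : ℝ) ≤ (Y.filter (good Q)).card := by exact_mod_cast h3
      have h4' : (Y.card : ℝ) ≤ X.card := by exact_mod_cast h4
      rw [← Finset.natCast_card_filter]
      by_cases hδ : 0 ≤ 1 - δ
      · nlinarith
      · have : (0 : ℝ) ≤ (Y.filter (good Q)).card := by positivity
        nlinarith
end Walk

/-! ### The parallel greedy algorithm -/

/-- The parameters of the parallel greedy algorithm: the ground sets, the fineness of the grid, the
number of samples per estimate, the accuracy, the number of rounds per threshold, and the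
multiplicities of the current point on the grid. -/
structure GreedyParams (α ι : Type*) where
  ground : ι → Set α
  K : ℕ
  M : ℕ
  K_pos : 0 < K
  M_pos : 0 < M
  δ : ℝ
  R : ℕ
  c : α → ℕ

/-- All elements sampled so far, the accepted ones among them, and the current candidates. -/
structure GreedyState (α : Type*) where
  sampled : Finset α
  accepted : Finset α
  cands : Finset α

/-- The grid point `c` increased by the indicator of `T`. -/
def bump {α : Type*} [DecidableEq α] (c : α → ℕ) (T : Finset α) (e : α) : ℕ :=
  c e + if e ∈ T then 1 else 0

namespace GreedyParams
variable {α ι : Type*} [Fintype α] [DecidableEq α] (P : GreedyParams α ι)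

/-- Samples used to estimate partial derivatives. -/
abbrev Samples : Type _ := Fin P.M → α → Fin P.K

instance : Nonempty P.Samples := ⟨fun _ _ => ⟨0, P.K_pos⟩⟩

/-- The estimate of the partial derivative with respect to `e` after adding `T`. -/
noncomputable def estimate (v : Finset α → ℝ) (ω : P.Samples) (T : Finset α) (e : α) : ℝ :=
  𝔼 k, sampleGain v (bump P.c T) e (ω k)

/-- An element is good if it is not blocked, and its estimated gain is at least `lam`. -/
def Good (ans : MatchoidQuery α ι → ℝ) (lam : ℝ) (ω : P.Samples) (T : Finset α) (e : α) : Prop :=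
  ¬ BlockedBy P.ground ans T e ∧ lam ≤ P.estimate (fun S => ans (.value S)) ω T e

open Classical in
/-- The state after walking along the list `l`. -/
noncomputable def step (ans : MatchoidQuery α ι → ℝ) (lam : ℝ) (ω : P.Samples) (l : List α)
    (st : GreedyState α) : GreedyState α where
  sampled := (walk (P.Good ans lam ω) st.cands P.δ l st.sampled st.accepted).1
  accepted := (walk (P.Good ans lam ω) st.cands P.δ l st.sampled st.accepted).2
  cands := st.cands.filter
    (P.Good ans lam ω (walk (P.Good ans lam ω) st.cands P.δ l st.sampled st.accepted).1)

variable [Fintype ι]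

open Classical in
/-- The queries that determine which elements are good with respect to the sets of `𝒯`. -/
noncomputable def queries (ω : P.Samples) (𝒯 : Finset (Finset α)) :
    Finset (MatchoidQuery α ι) :=
  (𝒯 ×ˢ (Finset.univ : Finset (α × ((Fin P.M × Bool) ⊕ (ι × Bool))))).image fun x =>
    match x with
    | (T, e, .inl (k, b)) =>
      .value (if b then insert e (sampleSet (bump P.c T) (ω k))
        else (sampleSet (bump P.c T) (ω k)).erase e)
    | (T, e, .inr (i, b)) => .rank i (if b then insert e T else T)

/-- Walk along the list `l`, with fresh samples. -/
noncomputable def probe (lam : ℝ) (l : List α) (st : GreedyState α) :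
    AdaptiveAlg (MatchoidQuery α ι) ℝ (GreedyState α) :=
  (AdaptiveAlg.uniform _ _ P.Samples).bind fun ω =>
    (AdaptiveAlg.ask (P.queries ω (prefixes l st.sampled))).bind fun ans =>
      .output (P.step ans lam ω l st)

/-- Repeatedly walk along random orderings of the candidates. -/
noncomputable def sweep (lam : ℝ) :
    ℕ → GreedyState α → AdaptiveAlg (MatchoidQuery α ι) ℝ (GreedyState α)
  | 0, st => .output st
  | r + 1, st =>
    (randomList _ _ st.cands.card st.cands).bind fun l => (P.probe lam l st).bind (sweep lam r)

/-- Process one threshold: determine the candidates, and sweep until no candidate is left. -/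
noncomputable def level (lam : ℝ) (st : GreedyState α) :
    AdaptiveAlg (MatchoidQuery α ι) ℝ (GreedyState α) :=
  -- The empty list samples nothing, so this probe only filters the whole ground set down to the
  -- good elements.
  (P.probe lam [] ⟨st.sampled, st.accepted, Finset.univ⟩).bind (P.sweep lam P.R)

/-- Process the thresholds `(1 - δ) * U`, `(1 - δ) ^ 2 * U`, ... -/
noncomputable def levels :
    ℕ → ℝ → GreedyState α → AdaptiveAlg (MatchoidQuery α ι) ℝ (GreedyState α)
  | 0, _, st => .output st
  | r + 1, U, st => (P.level ((1 - P.δ) * U) st).bind (levels r ((1 - P.δ) * U))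

/-- The parallel greedy algorithm with `L` thresholds. -/
noncomputable def greedy (L : ℕ) (Λ : ℝ) : AdaptiveAlg (MatchoidQuery α ι) ℝ (Finset α) :=
  (P.levels L Λ ⟨∅, ∅, ∅⟩).bind fun st => .output st.accepted

open Classical in
theorem card_queries_le (ω : P.Samples) (𝒯 : Finset (Finset α)) :
    (P.queries ω 𝒯).card ≤ 𝒯.card * (Fintype.card α * (2 * (P.M + Fintype.card ι))) := by
  refine Finset.card_image_le.trans ?_
  rw [Finset.card_product, Finset.card_univ]
  simp only [Fintype.card_prod, Fintype.card_sum, Fintype.card_fin, Fintype.card_bool]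
  apply le_of_eq
  ring

theorem good_congr {ans ans' : MatchoidQuery α ι → ℝ} {ω : P.Samples} {𝒯 : Finset (Finset α)}
    (h : ∀ q ∈ P.queries ω 𝒯, ans q = ans' q) (lam : ℝ) {T : Finset α} (hT : T ∈ 𝒯) (e : α) :
    P.Good ans lam ω T e ↔ P.Good ans' lam ω T e := by
  classical
  have hmem : ∀ x : α × ((Fin P.M × Bool) ⊕ (ι × Bool)), (T, x) ∈
      𝒯 ×ˢ (Finset.univ : Finset (α × ((Fin P.M × Bool) ⊕ (ι × Bool)))) := fun x =>
    Finset.mem_product.2 ⟨hT, Finset.mem_univ _⟩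
  have h1 : ∀ i, ans (.rank i (insert e T)) = ans' (.rank i (insert e T)) := fun i =>
    h _ (Finset.mem_image.2 ⟨_, hmem (e, .inr (i, true)), rfl⟩)
  have h2 : ∀ i, ans (.rank i T) = ans' (.rank i T) := fun i =>
    h _ (Finset.mem_image.2 ⟨_, hmem (e, .inr (i, false)), rfl⟩)
  have h3 : ∀ k, ans (.value (insert e (sampleSet (bump P.c T) (ω k)))) =
      ans' (.value (insert e (sampleSet (bump P.c T) (ω k)))) := fun k =>
    h _ (Finset.mem_image.2 ⟨_, hmem (e, .inl (k, true)), rfl⟩)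
  have h4 : ∀ k, ans (.value ((sampleSet (bump P.c T) (ω k)).erase e)) =
      ans' (.value ((sampleSet (bump P.c T) (ω k)).erase e)) := fun k =>
    h _ (Finset.mem_image.2 ⟨_, hmem (e, .inl (k, false)), rfl⟩)
  simp only [Good, BlockedBy, estimate, sampleGain, h1, h2, h3, h4]

theorem step_congr {ans ans' : MatchoidQuery α ι → ℝ} {ω : P.Samples} {l : List α}
    {st : GreedyState α} (h : ∀ q ∈ P.queries ω (prefixes l st.sampled), ans q = ans' q)
    (lam : ℝ) : P.step ans lam ω l st = P.step ans' lam ω l st := by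
  have hw := walk_congr (good := P.Good ans lam ω) (good' := P.Good ans' lam ω) (X := st.cands)
    (δ := P.δ) (l := l) (Q := st.sampled) (S := st.accepted)
    fun T hT e => P.good_congr h lam hT e
  classical
  rw [step, step, GreedyState.mk.injEq]
  refine ⟨by rw [hw.1], by rw [hw.1], ?_⟩
  ext e
  rw [Finset.mem_filter, Finset.mem_filter, ← hw.1, hw.2 e]

theorem expect_probe (oracle : MatchoidQuery α ι → ℝ) (lam : ℝ) (l : List α)
    (st : GreedyState α) (H : GreedyState α → ℝ) :
    (P.probe lam l st).expect oracle H = 𝔼 ω, H (P.step oracle lam ω l st) := by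
  rw [probe, AdaptiveAlg.expect_bind, AdaptiveAlg.expect_uniform]
  refine Finset.expect_congr rfl fun ω _ => ?_
  rw [AdaptiveAlg.expect_bind, AdaptiveAlg.expect_ask, AdaptiveAlg.expect]
  rw [P.step_congr (ans' := oracle)]
  intro q hq
  rw [if_pos hq]

/-- A bound on the number of queries per round. -/
def queryBound : ℝ :=
  (Fintype.card α + 1) * (Fintype.card α * (2 * (P.M + Fintype.card ι)))

theorem ensures_probe (oracle : MatchoidQuery α ι → ℝ) (lam : ℝ) {l : List α} (hl : l.Nodup)
    (st : GreedyState α) :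
    (P.probe lam l st).Ensures oracle P.queryBound
      (fun st' => ∃ ω, st' = P.step oracle lam ω l st) 1 := by
  rw [probe, show 1 = 0 + (1 + 0) from rfl]
  refine AdaptiveAlg.Ensures.bind (fun ω _ => ?_) (AdaptiveAlg.ensures_uniform oracle _)
  refine AdaptiveAlg.Ensures.bind (fun ans hans => ?_) (AdaptiveAlg.ensures_ask oracle _ ?_)
  · exact ⟨ω, P.step_congr hans lam⟩
  · have h1 : (prefixes l st.sampled).card ≤ Fintype.card α + 1 :=
      (card_prefixes_le _ _).trans (Nat.succ_le_succ hl.length_le_card)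
    have h2 := (P.card_queries_le ω (prefixes l st.sampled)).trans (Nat.mul_le_mul_right _ h1)
    rw [queryBound]
    exact_mod_cast h2

/-! ### Independence of the accepted set, and bounds on rounds and queries. -/

section Independence
variable {M : Matchoid α ι} {f : Finset α → ℝ}

/-- The accepted elements are among the sampled ones, and they are independent. -/
def Feasible (M : Matchoid α ι) (st : GreedyState α) : Prop :=
  st.accepted ⊆ st.sampled ∧ M.Indep st.accepted

omit [Fintype ι] in
theorem feasible_step (hG : M.groundSet = P.ground) (lam : ℝ) (ω : P.Samples) {l : List α}
    (hl : l.Nodup) {st : GreedyState α} (hlQ : ∀ e ∈ l, e ∉ st.sampled) (h : Feasible M st) :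
    Feasible M (P.step (matchoidOracle M f) lam ω l st) := by
  classical
  refine (walk_induct (P := fun Q S => S ⊆ Q ∧ M.Indep S) hl hlQ ?_ h).2
  intro T S e _ _ heT hTS
  split_ifs with hg
  · refine ⟨Finset.insert_subset_insert _ hTS.1, hTS.2.insert hTS.1 ?_⟩
    rw [← blockedBy_oracle_iff (f := f) hG]
    exact hg.1
  · exact ⟨hTS.1.trans (Finset.subset_insert _ _), hTS.2⟩

omit [Fintype ι] in
theorem cands_step_notMem (lam : ℝ) (ω : P.Samples) (l : List α) (st : GreedyState α)
    (ans : MatchoidQuery α ι → ℝ) :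
    ∀ e ∈ (P.step ans lam ω l st).cands, e ∉ (P.step ans lam ω l st).sampled := by
  classical
  intro e he hQ
  exact (Finset.mem_filter.1 he).2.1 (Or.inl hQ)

theorem ensures_sweep (hG : M.groundSet = P.ground) (lam : ℝ) (r : ℕ) {st : GreedyState α}
    (hQ : ∀ e ∈ st.cands, e ∉ st.sampled) (h : Feasible M st) :
    (P.sweep lam r st).Ensures (matchoidOracle M f) P.queryBound (Feasible M) r := by
  induction r generalizing st with
  | zero => exact h
  | succ r ih =>
    -- Drawing the ordering costs no round, the probe costs one.
    rw [sweep, show r + 1 = 0 + (1 + r) by omega]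
    refine AdaptiveAlg.Ensures.bind (fun l hl => ?_) (ensures_randomList _ _ _ _)
    refine AdaptiveAlg.Ensures.bind ?_ (P.ensures_probe _ lam hl.1 st)
    rintro st' ⟨ω, rfl⟩
    exact ih (P.cands_step_notMem lam ω l st _)
      (P.feasible_step hG lam ω hl.1 (fun e he => hQ e (hl.2 e he)) h)

theorem ensures_level (hG : M.groundSet = P.ground) (lam : ℝ) {st : GreedyState α}
    (h : Feasible M st) :
    (P.level lam st).Ensures (matchoidOracle M f) P.queryBound (Feasible M) (P.R + 1) := by
  rw [level, add_comm]
  refine AdaptiveAlg.Ensures.bind ?_ (P.ensures_probe _ lam List.nodup_nil _)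
  rintro st' ⟨ω, rfl⟩
  exact P.ensures_sweep hG lam _ (P.cands_step_notMem lam ω _ _ _)
    (P.feasible_step hG lam ω List.nodup_nil (by simp) h)

theorem ensures_levels (hG : M.groundSet = P.ground) (L : ℕ) (U : ℝ) {st : GreedyState α}
    (h : Feasible M st) :
    (P.levels L U st).Ensures (matchoidOracle M f) P.queryBound (Feasible M)
      (L * (P.R + 1)) := by
  induction L generalizing U st with
  | zero => exact h
  | succ L ih =>
    rw [levels, Nat.succ_mul, add_comm]
    exact AdaptiveAlg.Ensures.bind (fun st' h' => ih _ h') (P.ensures_level hG _ h)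

theorem ensures_greedy (hG : M.groundSet = P.ground) (L : ℕ) (Λ : ℝ) :
    (P.greedy L Λ).Ensures (matchoidOracle M f) P.queryBound M.Indep (L * (P.R + 1)) := by
  rw [greedy, ← Nat.add_zero (L * _)]
  exact AdaptiveAlg.Ensures.bind (fun st h => h.2)
    (P.ensures_levels hG L Λ ⟨subset_rfl, M.indep_empty⟩)

end Independence
end GreedyParams

/-! ### Analysis of the parallel greedy algorithm -/

section Bump
variable {α : Type*} [DecidableEq α]

theorem bump_mono (c : α → ℕ) {S T : Finset α} (h : S ⊆ T) : bump c S ≤ bump c T := by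
  intro e
  rw [bump, bump]
  by_cases he : e ∈ S
  · rw [if_pos he, if_pos (h he)]
  · rw [if_neg he]
    exact Nat.add_le_add_left (Nat.zero_le _) _

theorem bump_insert (c : α → ℕ) {T : Finset α} {e : α} (he : e ∉ T) :
    bump c (insert e T) = Function.update (bump c T) e (bump c T e + 1) := by
  ext x
  by_cases hx : x = e
  · subst hx
    simp [bump, he]
  · simp [bump, hx]

theorem bump_empty (c : α → ℕ) : bump c ∅ = c := by
  ext x
  simp [bump]

end Bump

namespace GreedyParams
variable {α ι : Type*} [Fintype α] [DecidableEq α] (P : GreedyParams α ι)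

/-- The true gain of `e` after adding `T`. -/
noncomputable def gain (f : Finset α → ℝ) (T : Finset α) (e : α) : ℝ :=
  meanGain f P.K (bump P.c T) e

/-- The value after adding `T`. -/
noncomputable def value (f : Finset α → ℝ) (T : Finset α) : ℝ :=
  gridValue f P.K (bump P.c T)

theorem gain_anti {f : Finset α → ℝ} (hf : IsMonotoneSubmodular f) {S T : Finset α} (h : S ⊆ T)
    (e : α) : P.gain f T e ≤ P.gain f S e :=
  meanGain_anti hf _ (bump_mono _ h) e

theorem value_insert (f : Finset α → ℝ) (hc : ∀ e, P.c e < P.K) {T : Finset α} {e : α}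
    (he : e ∉ T) : P.K * (P.value f (insert e T) - P.value f T) = P.gain f T e := by
  rw [value, value, bump_insert _ he]
  exact gridValue_update_sub _ _ (by simpa [bump, he] using hc e)

open Classical in
/-- The state of the algorithm while the thresholds are at most `U`, compared with an independent
set `O`: `a` and `b` are the total thresholds of the accepted and of the sampled elements, and
`Δ` bounds the errors of the estimates. -/
structure Inv (M : Matchoid α ι) (f : Finset α → ℝ) (p : ℕ) (O : Finset α) (U a b Δ : ℝ)
    (Q S : Finset α) : Prop where
  sub : S ⊆ Q
  low : a - S.card * Δ ≤ P.K * (P.value f S - P.value f ∅)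
  up : P.K * (P.value f Q - P.value f ∅) ≤ b + Q.card * Δ
  -- Each sampled element provides `p` units of charge, each blocked element of `O` consumes one,
  -- and unused units are kept at the current price `U`. This replaces an explicit assignment of
  -- blocked elements to sampled ones.
  charge : ∑ o ∈ O.filter (M.Blocked Q), P.gain f Q o +
    ((p : ℝ) * Q.card - (O.filter (M.Blocked Q)).card) * U ≤
      p * b + (O.filter (M.Blocked Q)).card * Δ
  rest : ∀ o, ¬ M.Blocked Q o → P.gain f Q o ≤ U + Δ

variable {P} {M : Matchoid α ι} {f : Finset α → ℝ} {p : ℕ} {O : Finset α} {U a b Δ : ℝ}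
  {Q S : Finset α}

theorem Inv.mono_error (h : P.Inv M f p O U a b Δ Q S) {Δ' : ℝ} (hΔ : Δ ≤ Δ') :
    P.Inv M f p O U a b Δ' Q S where
  sub := h.sub
  low := le_trans (by gcongr) h.low
  up := h.up.trans (by gcongr)
  charge := h.charge.trans (by gcongr)
  rest := fun o ho => (h.rest o ho).trans (by gcongr)

/-- By `card_blocked_le` the number of unused units of charge is nonnegative, so lowering their
price preserves `charge`. -/
theorem Inv.lower [Fintype ι] (hp : 1 ≤ p) (hM : M.IsPMatchoid p) (hO : M.Indep O)
    (h : P.Inv M f p O U a b Δ Q S) {U' : ℝ} (hU : U' ≤ U)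
    (hrest : ∀ o, ¬ M.Blocked Q o → P.gain f Q o ≤ U' + Δ) :
    P.Inv M f p O U' a b Δ Q S where
  sub := h.sub
  low := h.low
  up := h.up
  charge := by
    classical
    refine le_trans ?_ h.charge
    have h1 : ((O.filter (M.Blocked Q)).card : ℝ) ≤ p * Q.card := by
      exact_mod_cast M.card_blocked_le hp hM hO Q
    have h2 : (0 : ℝ) ≤ p * Q.card - (O.filter (M.Blocked Q)).card := sub_nonneg.2 h1
    gcongr
  rest := hrest

theorem Inv.insert_sampled (hf : IsMonotoneSubmodular f) (hc : ∀ e, P.c e < P.K)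
    (h : P.Inv M f p O U a b Δ Q S) {e : α} (he : e ∉ Q) (heU : P.gain f Q e ≤ U + Δ) :
    P.Inv M f p O U a (b + U) Δ (insert e Q) S where
  sub := h.sub.trans (Finset.subset_insert _ _)
  low := h.low
  up := by
    have h1 := P.value_insert f hc he
    have h2 := h.up
    rw [Finset.card_insert_of_notMem he]
    push_cast
    linarith
  charge := by
    classical
    set B := O.filter (M.Blocked Q) with hB
    set B' := O.filter (M.Blocked (insert e Q)) with hB'
    have hsub : B ⊆ B' := fun o ho => by
      rw [hB, Finset.mem_filter] at ho
      rw [hB', Finset.mem_filter]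
      exact ⟨ho.1, ho.2.mono (Finset.subset_insert _ _)⟩
    have h1 : ∑ o ∈ B', P.gain f (insert e Q) o ≤ ∑ o ∈ B', P.gain f Q o :=
      Finset.sum_le_sum fun o _ => P.gain_anti hf (Finset.subset_insert _ _) o
    have h2 := Finset.sum_sdiff (f := fun o => P.gain f Q o) hsub
    have h3 : ∑ o ∈ B' \ B, P.gain f Q o ≤ (B' \ B).card • (U + Δ) := by
      refine Finset.sum_le_card_nsmul _ _ _ fun o ho => h.rest o fun hb => ?_
      rw [Finset.mem_sdiff, hB', hB, Finset.mem_filter, Finset.mem_filter] at ho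
      exact ho.2 ⟨ho.1.1, hb⟩
    rw [nsmul_eq_mul] at h3
    have h4 : ((B' \ B).card : ℝ) + B.card = B'.card := by
      exact_mod_cast Finset.card_sdiff_add_card_eq_card hsub
    have h5 := h.charge
    rw [← hB] at h5
    rw [Finset.card_insert_of_notMem he, ← h4]
    push_cast
    linarith
  rest := fun o ho => (P.gain_anti hf (Finset.subset_insert _ _) o).trans
    (h.rest o fun hb => ho (hb.mono (Finset.subset_insert _ _)))

/-- The gain is tested against `Q`, but `S ⊆ Q`, so the gain over `S` is at least as large. -/
theorem Inv.insert_accepted (hf : IsMonotoneSubmodular f) (hc : ∀ e, P.c e < P.K)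
    (h : P.Inv M f p O U a b Δ Q S) {e : α} {lam : ℝ} (he : e ∉ Q) (heU : P.gain f Q e ≤ U + Δ)
    (hel : lam - Δ ≤ P.gain f Q e) :
    P.Inv M f p O U (a + lam) (b + U) Δ (insert e Q) (insert e S) := by
  have h' := h.insert_sampled hf hc he heU
  refine ⟨Finset.insert_subset_insert _ h.sub, ?_, h'.up, h'.charge, h'.rest⟩
  have heS : e ∉ S := fun hS => he (h.sub hS)
  have h1 := P.value_insert f hc heS
  have h2 := P.gain_anti hf h.sub e
  have h3 := h.low
  rw [Finset.card_insert_of_notMem heS]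
  push_cast
  linarith

theorem inv_empty [Fintype ι] (hf : IsMonotoneSubmodular f) (hp : 1 ≤ p) (hM : M.IsPMatchoid p)
    (hO : M.Indep O) (hU : ∀ e, ¬ M.Blocked ∅ e → f {e} ≤ U) :
    P.Inv M f p O U 0 0 0 ∅ ∅ where
  sub := subset_rfl
  low := by simp
  up := by simp
  charge := by
    classical
    have h := M.card_blocked_le hp hM hO ∅
    rw [Finset.card_empty, mul_zero, Nat.le_zero, Finset.card_eq_zero] at h
    rw [h]
    simp
  rest := fun o ho => by
    rw [add_zero]
    exact (meanGain_le hf P.K_pos _ o).trans (hU o ho)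

/-- The consequence of the invariant for the state at the end. -/
theorem Inv.final [Fintype ι] (hf : IsMonotoneSubmodular f) (hp : 1 ≤ p) (hM : M.IsPMatchoid p)
    (hO : M.Indep O) {θ : ℝ} (hθ0 : 0 ≤ θ) (hθ1 : θ ≤ 1) (hU : 0 ≤ U) (hΔ : 0 ≤ Δ)
    (h : P.Inv M f p O U a b Δ Q S) :
    θ / (p + 1 / P.K) * (f O - P.value f ∅ - Fintype.card α * U) + (a - θ * b) -
      3 * Fintype.card α * Δ ≤ P.K * (P.value f S - P.value f ∅) := by
  classical
  have hK : (0 : ℝ) < P.K := by exact_mod_cast P.K_pos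
  have hK1 : (1 : ℝ) ≤ P.K := by exact_mod_cast P.K_pos
  have hp' : (1 : ℝ) ≤ p := by exact_mod_cast hp
  set n : ℝ := (Fintype.card α : ℝ) with hn
  have hn0 : 0 ≤ n := by positivity
  set B := O.filter (M.Blocked Q) with hB
  set B' := O.filter (fun o => ¬ M.Blocked Q o) with hB'
  have h1 := le_gridValue_add_sum_meanGain hf P.K_pos (bump P.c Q) O
  have h2 : ∑ o ∈ O, P.gain f Q o = ∑ o ∈ B, P.gain f Q o + ∑ o ∈ B', P.gain f Q o :=
    (Finset.sum_filter_add_sum_filter_not _ _ _).symm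
  have h3 : ∑ o ∈ B', P.gain f Q o ≤ B'.card • (U + Δ) :=
    Finset.sum_le_card_nsmul _ _ _ fun o ho => h.rest o (Finset.mem_filter.1 ho).2
  rw [nsmul_eq_mul] at h3
  have hcard : (B.card : ℝ) + B'.card = O.card := by
    exact_mod_cast Finset.card_filter_add_card_filter_not (s := O) (M.Blocked Q)
  have hOn : (O.card : ℝ) ≤ n := by
    rw [hn]; exact_mod_cast Finset.card_le_univ O
  have hQn : (Q.card : ℝ) ≤ n := by
    rw [hn]; exact_mod_cast Finset.card_le_univ Q
  have hSn : (S.card : ℝ) ≤ n := by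
    rw [hn]; exact_mod_cast Finset.card_le_univ S
  have hB0 : (0 : ℝ) ≤ B.card := by positivity
  have hB'0 : (0 : ℝ) ≤ B'.card := by positivity
  have hBQ : (B.card : ℝ) ≤ p * Q.card := by exact_mod_cast M.card_blocked_le hp hM hO Q
  have h4 := h.charge
  rw [← hB] at h4
  have h5 : 0 ≤ ((p : ℝ) * Q.card - B.card) * U := mul_nonneg (sub_nonneg.2 hBQ) hU
  have h6 : P.value f Q - P.value f ∅ ≤ (b + Q.card * Δ) / P.K := by
    rw [le_div_iff₀ hK, mul_comm]
    exact h.up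
  have h7 : (b + Q.card * Δ) / P.K ≤ b / P.K + n * Δ := by
    rw [add_div]
    gcongr
    rw [div_le_iff₀ hK]
    have : Q.card * Δ ≤ n * Δ := by gcongr
    have h8 : n * Δ * 1 ≤ n * Δ * P.K := by gcongr
    linarith
  have h8 : B'.card * U ≤ n * U := by
    gcongr
    linarith
  have h9 : (B.card + B'.card : ℝ) * Δ ≤ n * Δ := by
    gcongr
    linarith
  have h10 : f O ≤ P.value f Q + ∑ o ∈ O, P.gain f Q o := h1
  set κ : ℝ := p + 1 / P.K with hκ
  have hκ1 : 1 ≤ κ := by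
    have : 0 ≤ 1 / (P.K : ℝ) := by positivity
    linarith
  -- Of `κ = p + 1 / K`, the part `p` pays for the blocked elements and `1 / K` for the value of
  -- `Q`. One `n * Δ` comes from the elements of `O`, one from `up`; the third one in the conclusion
  -- comes from `low`.
  have h11 : f O - P.value f ∅ - n * U ≤ κ * b + 2 * n * Δ := by
    have : κ * b = p * b + b / P.K := by rw [hκ]; ring
    rw [this]
    nlinarith
  have h12 : θ / κ * (f O - P.value f ∅ - n * U) ≤ θ * b + 2 * n * Δ := by
    calc θ / κ * (f O - P.value f ∅ - n * U) ≤ θ / κ * (κ * b + 2 * n * Δ) := by gcongr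
      _ = θ * b + θ / κ * (2 * n * Δ) := by field_simp
      _ ≤ θ * b + 1 * (2 * n * Δ) := by
          gcongr
          rw [div_le_one (by linarith)]
          linarith
      _ = θ * b + 2 * n * Δ := by ring
  have h13 : S.card * Δ ≤ n * Δ := by gcongr
  have := h.low
  linarith

/-! #### One step -/

variable (P M f) in
open Classical in
/-- The total error of the estimates for the set `T`. -/
noncomputable def error (ω : P.Samples) (T : Finset α) : ℝ :=
  -- Blocked elements are never tested against a threshold, and their gains need not be bounded by
  -- the largest unblocked singleton value.
  ∑ e, if M.Blocked T e then 0 else |P.estimate f ω T e - P.gain f T e|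

theorem error_nonneg (ω : P.Samples) (T : Finset α) : 0 ≤ P.error M f ω T := by
  classical
  refine Finset.sum_nonneg fun e _ => ?_
  split_ifs
  · exact le_rfl
  · exact abs_nonneg _

theorem abs_estimate_sub_le (ω : P.Samples) {T : Finset α} {e : α} (he : ¬ M.Blocked T e) :
    |P.estimate f ω T e - P.gain f T e| ≤ P.error M f ω T := by
  classical
  have := Finset.single_le_sum (s := Finset.univ)
    (f := fun e => if M.Blocked T e then 0 else |P.estimate f ω T e - P.gain f T e|)
    (fun e _ => by split_ifs <;> [exact le_rfl; exact abs_nonneg _]) (Finset.mem_univ e)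
  simpa [he, error] using this

variable (P M f) in
/-- The total error of the estimates along a list. -/
noncomputable def listError (ω : P.Samples) (l : List α) (Q : Finset α) : ℝ :=
  ∑ T ∈ prefixes l Q, P.error M f ω T

theorem listError_nonneg (ω : P.Samples) (l : List α) (Q : Finset α) :
    0 ≤ P.listError M f ω l Q :=
  Finset.sum_nonneg fun _ _ => error_nonneg ω _

theorem error_le_listError (ω : P.Samples) {l : List α} {Q T : Finset α} (hT : T ∈ prefixes l Q) :
    P.error M f ω T ≤ P.listError M f ω l Q :=
  Finset.single_le_sum (f := fun T => P.error M f ω T) (fun _ _ => error_nonneg ω _) hT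

theorem expect_listError_le {η : ℝ}
    (hη : ∀ T e, ¬ M.Blocked T e → 𝔼 ω : P.Samples, |P.estimate f ω T e - P.gain f T e| ≤ η)
    (hη0 : 0 ≤ η) {l : List α} (hl : l.Nodup) (Q : Finset α) :
    𝔼 ω : P.Samples, P.listError M f ω l Q ≤
      (Fintype.card α + 1) * (Fintype.card α * η) := by
  classical
  have h1 : ∀ T, 𝔼 ω : P.Samples, P.error M f ω T ≤ Fintype.card α * η := by
    intro T
    simp only [error]
    rw [Finset.expect_sum_comm]
    calc _ ≤ ∑ _e : α, η := by
          refine Finset.sum_le_sum fun e _ => ?_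
          split_ifs with h
          · simpa using hη0
          · exact hη T e h
      _ = Fintype.card α * η := by simp
  simp only [listError]
  rw [Finset.expect_sum_comm]
  calc _ ≤ ∑ _T ∈ prefixes l Q, Fintype.card α * η := Finset.sum_le_sum fun T _ => h1 T
    _ = (prefixes l Q).card * (Fintype.card α * η) := by simp
    _ ≤ (Fintype.card α + 1) * (Fintype.card α * η) := by
        gcongr
        exact_mod_cast (card_prefixes_le l Q).trans (Nat.succ_le_succ hl.length_le_card)

/-- Once its candidates are determined, only candidates can still exceed the threshold. -/
def CandsInv (P : GreedyParams α ι) (M : Matchoid α ι) (f : Finset α → ℝ) (lam Δ : ℝ)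
    (st : GreedyState α) : Prop :=
  ∀ o, ¬ M.Blocked st.sampled o → o ∉ st.cands → P.gain f st.sampled o ≤ lam + Δ

theorem good_oracle_iff (hG : M.groundSet = P.ground) {lam : ℝ} {ω : P.Samples} {T : Finset α}
    {e : α} : P.Good (matchoidOracle M f) lam ω T e ↔
      ¬ M.Blocked T e ∧ lam ≤ P.estimate f ω T e := by
  rw [Good, blockedBy_oracle_iff hG]
  rfl

/-- The error of the whole list is added to the budget in advance, so that one `Δ'` serves at all
prefixes. Gains only decrease along the walk, so the bound by `U` at its start persists. -/
theorem inv_step (hf : IsMonotoneSubmodular f) (hG : M.groundSet = P.ground)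
    (hc : ∀ e, P.c e < P.K) {st : GreedyState α} {lam : ℝ} (hΔ0 : 0 ≤ Δ)
    (h : P.Inv M f p O U a b Δ st.sampled st.accepted) (ω : P.Samples) {l : List α}
    (hl : l.Nodup) (hlQ : ∀ e ∈ l, ¬ M.Blocked st.sampled e) {st' : GreedyState α}
    (hst : st' = P.step (matchoidOracle M f) lam ω l st) :
    P.Inv M f p O U (a + lam * (st'.accepted.card - st.accepted.card))
      (b + U * (st'.sampled.card - st.sampled.card)) (Δ + P.listError M f ω l st.sampled)
      st'.sampled st'.accepted ∧ st.sampled ⊆ st'.sampled ∧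
      st'.sampled ∈ prefixes l st.sampled := by
  classical
  set Δ' := Δ + P.listError M f ω l st.sampled with hΔ'
  have hle := listError_nonneg (P := P) (M := M) (f := f) ω l st.sampled
  have hΔ : Δ ≤ Δ' := by linarith
  have key := walk_induct (good := P.Good (matchoidOracle M f) lam ω) (X := st.cands) (δ := P.δ)
    (Q := st.sampled) (S := st.accepted) (P := fun Q S => P.Inv M f p O U (a + lam * (S.card - st.accepted.card))
      (b + U * (Q.card - st.sampled.card)) Δ' Q S) hl
    (fun e he hQ => hlQ e he (Or.inl hQ)) (fun T S e hT hel heT hI => ?_)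
    (by simpa using h.mono_error hΔ)
  · subst hst
    exact ⟨key.2, subset_of_mem_prefixes key.1, key.1⟩
  · have hU : P.gain f T e ≤ U + Δ' :=
      (P.gain_anti hf (subset_of_mem_prefixes hT) e).trans
        ((h.rest e (hlQ e hel)).trans (by gcongr))
    have hcT : ((insert e T).card : ℝ) = T.card + 1 := by
      rw [Finset.card_insert_of_notMem heT]; push_cast; rfl
    split_ifs with hg
    · rw [good_oracle_iff hG] at hg
      have h1 := (abs_le.1 (abs_estimate_sub_le (f := f) ω hg.1)).2
      have h2 := error_le_listError (M := M) (f := f) ω hT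
      have h3 : lam - Δ' ≤ P.gain f T e := by linarith
      have hcS : ((insert e S).card : ℝ) = S.card + 1 := by
        rw [Finset.card_insert_of_notMem fun hS => heT (hI.sub hS)]; push_cast; rfl
      have h4 := hI.insert_accepted hf hc heT hU h3
      rw [hcT, hcS]
      convert h4 using 1 <;> ring
    · have h4 := hI.insert_sampled hf hc heT hU
      rw [hcT]
      convert h4 using 1
      ring

/-- An unblocked element that is dropped has its estimate below `lam`, hence its gain below `lam`
plus the error; for those dropped earlier, gains have only decreased since. -/
theorem candsInv_step (hf : IsMonotoneSubmodular f) (hG : M.groundSet = P.ground)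
    {st : GreedyState α} {lam : ℝ} (hΔ0 : 0 ≤ Δ) (h : CandsInv P M f lam Δ st) (ω : P.Samples)
    {l : List α} {st' : GreedyState α} (hst : st' = P.step (matchoidOracle M f) lam ω l st)
    (hsub : st.sampled ⊆ st'.sampled) (hpre : st'.sampled ∈ prefixes l st.sampled) :
    CandsInv P M f lam (Δ + P.listError M f ω l st.sampled) st' := by
  classical
  intro o ho hcand
  have hle := error_le_listError (M := M) (f := f) ω hpre
  have h0 := error_nonneg (M := M) (f := f) ω st'.sampled
  by_cases hmem : o ∈ st.cands
  · have h1 : ¬ lam ≤ P.estimate f ω st'.sampled o := by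
      intro hest
      refine hcand ?_
      subst hst
      exact Finset.mem_filter.2 ⟨hmem, (good_oracle_iff hG).2 ⟨ho, hest⟩⟩
    have h2 := (abs_le.1 (abs_estimate_sub_le (f := f) ω ho)).1
    linarith
  · have h1 := h o (fun hb => ho (hb.mono hsub)) hmem
    have h2 := P.gain_anti hf hsub o
    linarith

theorem not_blocked_of_mem_cands_step (hG : M.groundSet = P.ground) (lam : ℝ) (ω : P.Samples)
    (l : List α) (st : GreedyState α) :
    ∀ e ∈ (P.step (matchoidOracle M f) lam ω l st).cands,
      ¬ M.Blocked (P.step (matchoidOracle M f) lam ω l st).sampled e := by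
  classical
  intro e he
  exact ((good_oracle_iff hG).1 (Finset.mem_filter.1 he).2).1

/-- The number `r` of remaining sweeps suffices to exhaust the candidates. -/
def Exhausts (P : GreedyParams α ι) (r : ℕ) (m : ℕ) : Prop :=
  m ≤ r ∨ (1 - P.δ) ^ r * m < 1

omit [Fintype α] [DecidableEq α] in
-- The two alternatives reflect two ways to count progress: a sweep removes at least one candidate,
-- and it shrinks their number by the factor `1 - δ`.
theorem Exhausts.step (hδ0 : 0 < P.δ) (hδ1 : P.δ < 1) {r m m' : ℕ} (h : P.Exhausts (r + 1) m)
    (hm : (m' : ℝ) ≤ (1 - P.δ) * m) : P.Exhausts r m' := by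
  rcases h with h | h
  · left
    rcases Nat.eq_zero_or_pos m with h0 | h0
    · subst h0
      have : (m' : ℝ) ≤ 0 := by simpa using hm
      have : m' ≤ 0 := by exact_mod_cast this
      omega
    · have h1 : (m' : ℝ) < m := by
        have : (0 : ℝ) < m := by exact_mod_cast h0
        nlinarith
      have : m' < m := by exact_mod_cast h1
      omega
  · right
    refine lt_of_le_of_lt ?_ h
    rw [pow_succ, mul_assoc]
    have : 0 ≤ 1 - P.δ := by linarith
    gcongr

omit [Fintype α] [DecidableEq α] in
theorem Exhausts.eq_zero {m : ℕ} (h : P.Exhausts 0 m) : m = 0 := by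
  rcases h with h | h
  · omega
  · rw [pow_zero, one_mul] at h
    have : m < 1 := by exact_mod_cast h
    omega

/-- The expected change of the potential in one round is controlled by the errors. -/
theorem listExpect_potential_le (hδ1 : P.δ < 1) (hU : 0 ≤ U)
    {η : ℝ} (hη : ∀ T e, ¬ M.Blocked T e →
      𝔼 ω : P.Samples, |P.estimate f ω T e - P.gain f T e| ≤ η) (hη0 : 0 ≤ η)
    {β γ : ℝ} (hβ : 0 ≤ β) (hγ : 0 ≤ γ) {st : GreedyState α} (hsub : st.accepted ⊆ st.sampled)
    (hcands : ∀ e ∈ st.cands, e ∉ st.sampled) (V : ℝ) :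
    V - γ * ((Fintype.card α + 1) * (Fintype.card α * η)) ≤
      listExpect st.cands.card st.cands fun l => 𝔼 ω : P.Samples,
        (V + (β * ((1 - P.δ) * U * (((P.step (matchoidOracle M f) ((1 - P.δ) * U) ω l st).accepted.card
          : ℝ) - st.accepted.card) -
          (1 - P.δ) ^ 2 * (U * (((P.step (matchoidOracle M f) ((1 - P.δ) * U) ω l st).sampled.card
            : ℝ) - st.sampled.card))) - γ * P.listError M f ω l st.sampled)) := by
  have h1 : ∀ ω : P.Samples, 0 ≤ listExpect st.cands.card st.cands fun l =>
      β * ((1 - P.δ) * U * (((P.step (matchoidOracle M f) ((1 - P.δ) * U) ω l st).accepted.card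
          : ℝ) - st.accepted.card) -
          (1 - P.δ) ^ 2 * (U * (((P.step (matchoidOracle M f) ((1 - P.δ) * U) ω l st).sampled.card
            : ℝ) - st.sampled.card))) := by
    intro ω
    have h2 := listExpect_walk_nonneg (good := P.Good (matchoidOracle M f) ((1 - P.δ) * U) ω)
      (X := st.cands) (δ := P.δ) (fun T e hg hT => hg.1 (Or.inl hT)) st.cands.card
      (Y := st.cands) (Q := st.sampled) (S := st.accepted) rfl subset_rfl hcands
      (fun e he => Or.inl he) hsub
    have h3 : 0 ≤ β * ((1 - P.δ) * U) := by
      have : 0 ≤ 1 - P.δ := by linarith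
      positivity
    have h4 := mul_nonneg h3 h2
    rw [← listExpect_mul] at h4
    refine h4.trans_eq ?_
    congr 1
    ext l
    simp only [step]
    ring
  have h5 : listExpect st.cands.card st.cands (fun l =>
      -γ * 𝔼 ω : P.Samples, P.listError M f ω l st.sampled) ≥
        listExpect st.cands.card st.cands fun _ =>
          -γ * ((Fintype.card α + 1) * (Fintype.card α * η)) := by
    refine listExpect_mono rfl fun l hl _ => ?_
    have := expect_listError_le hη hη0 hl st.sampled
    rw [neg_mul, neg_mul]
    exact neg_le_neg (by gcongr)
  rw [listExpect_const] at h5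
  have h6 : 0 ≤ listExpect st.cands.card st.cands fun l => 𝔼 ω : P.Samples,
      β * ((1 - P.δ) * U * (((P.step (matchoidOracle M f) ((1 - P.δ) * U) ω l st).accepted.card
          : ℝ) - st.accepted.card) -
          (1 - P.δ) ^ 2 * (U * (((P.step (matchoidOracle M f) ((1 - P.δ) * U) ω l st).sampled.card
            : ℝ) - st.sampled.card))) := by
    -- Ordering and samples are independent: the drift is averaged over orderings for fixed samples,
    -- whereas the errors above were averaged over samples for a fixed ordering.
    rw [listExpect_expect_comm _ _ fun (ω : P.Samples) l => β * ((1 - P.δ) * U * _ - _)]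
    exact Finset.expect_nonneg fun ω _ => h1 ω
  simp only [Finset.expect_add_distrib, Fintype.expect_const,
    ← Finset.mul_expect, sub_eq_add_neg, ← neg_mul, listExpect_add, listExpect_const] at h5 h6 ⊢
  linarith

end GreedyParams

/-! ### Expected value of the greedy algorithm, from one threshold to the whole run. -/

namespace GreedyParams
variable {α ι : Type*} [Fintype α] [DecidableEq α] [Fintype ι] {P : GreedyParams α ι}
  {M : Matchoid α ι} {f : Finset α → ℝ} {p : ℕ} {O : Finset α}

/-- The expected loss in one round that is due to the errors of the estimates. -/
noncomputable def roundLoss (_P : GreedyParams α ι) (γ η : ℝ) : ℝ :=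
  γ * ((Fintype.card α + 1) * (Fintype.card α * η))

/-- Backward induction: `H` is the expected payoff of what follows, and `V + β * (a - (1 - δ) ^ 2 *
b) - γ * Δ` is a potential that bounds it from below. The factor `(1 - δ) ^ 2` combines acceptance
at `(1 - δ) * U` with the share `1 - δ` of accepted elements, so each sweep loses only `roundLoss`
in expectation. -/
theorem le_expect_sweep (hf : IsMonotoneSubmodular f) (hG : M.groundSet = P.ground)
    (hc : ∀ e, P.c e < P.K) (hp : 1 ≤ p) (hM : M.IsPMatchoid p) (hO : M.Indep O)
    (hδ0 : 0 < P.δ) (hδ1 : P.δ < 1) {η : ℝ}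
    (hη : ∀ T e, ¬ M.Blocked T e → 𝔼 ω : P.Samples, |P.estimate f ω T e - P.gain f T e| ≤ η)
    (hη0 : 0 ≤ η) {β γ : ℝ} (hβ : 0 ≤ β) (hγ : 0 ≤ γ) {U : ℝ} (hU : 0 ≤ U) {V : ℝ}
    {H : GreedyState α → ℝ}
    (hH : ∀ st a b Δ, 0 ≤ Δ →
      P.Inv M f p O ((1 - P.δ) * U) a b Δ st.sampled st.accepted →
        V + β * (a - (1 - P.δ) ^ 2 * b) - γ * Δ ≤ H st)
    (r : ℕ) (st : GreedyState α) (a b Δ : ℝ) (hΔ : 0 ≤ Δ)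
    (hI : P.Inv M f p O U a b Δ st.sampled st.accepted)
    (hC : CandsInv P M f ((1 - P.δ) * U) Δ st)
    (hcands : ∀ e ∈ st.cands, ¬ M.Blocked st.sampled e) (hr : P.Exhausts r st.cands.card) :
    V + β * (a - (1 - P.δ) ^ 2 * b) - γ * Δ - r * P.roundLoss γ η ≤
      (P.sweep ((1 - P.δ) * U) r st).expect (matchoidOracle M f) H := by
  induction r generalizing st a b Δ with
  | zero =>
    have h0 := hr.eq_zero
    rw [Finset.card_eq_zero] at h0
    simp only [Nat.cast_zero, zero_mul, sub_zero, sweep, AdaptiveAlg.expect]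
    -- No candidate is left, so all unblocked gains are below the threshold up to `Δ`, and `U` can
    -- be replaced by `(1 - δ) * U`.
    refine hH st a b Δ hΔ (hI.lower hp hM hO (by nlinarith) fun o ho => hC o ho ?_)
    simp [h0]
  | succ r ih =>
    rw [sweep, AdaptiveAlg.expect_bind, expect_randomList]
    simp only [AdaptiveAlg.expect_bind, expect_probe]
    have hpot := listExpect_potential_le (M := M) (f := f) hδ1 hU hη hη0 hβ hγ hI.sub
      (fun e he hQ => hcands e he (Or.inl hQ))
      (V + β * (a - (1 - P.δ) ^ 2 * b) - γ * Δ - r * P.roundLoss γ η)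
    refine le_trans (le_of_eq ?_) (hpot.trans ?_)
    · rw [roundLoss]
      push_cast
      ring
    refine listExpect_mono rfl fun l hl hlX => Finset.expect_le_expect fun ω _ => ?_
    have hmem : ∀ e ∈ l, ¬ M.Blocked st.sampled e := fun e he =>
      hcands e (hlX ▸ List.mem_toFinset.2 he)
    obtain ⟨h1, h2, h3⟩ := inv_step (lam := (1 - P.δ) * U) hf hG hc hΔ hI ω hl hmem rfl
    have h4 := candsInv_step hf hG hΔ hC ω rfl h2 h3
    have h5 := ih _ _ _ _ (add_nonneg hΔ (listError_nonneg ω l st.sampled)) h1 h4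
      (not_blocked_of_mem_cands_step hG _ ω l st) (hr.step hδ0 hδ1
        (card_filter_good_walk_le hδ1.le (fun T e hg hT => hg.1 (Or.inl hT)) fun e he =>
          Or.inr (List.mem_toFinset.1 (hlX.symm ▸ he))))
    refine le_trans (le_of_eq ?_) h5
    ring

theorem le_expect_level (hf : IsMonotoneSubmodular f) (hG : M.groundSet = P.ground)
    (hc : ∀ e, P.c e < P.K) (hp : 1 ≤ p) (hM : M.IsPMatchoid p) (hO : M.Indep O)
    (hδ0 : 0 < P.δ) (hδ1 : P.δ < 1) (hR : P.Exhausts P.R (Fintype.card α)) {η : ℝ}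
    (hη : ∀ T e, ¬ M.Blocked T e → 𝔼 ω : P.Samples, |P.estimate f ω T e - P.gain f T e| ≤ η)
    (hη0 : 0 ≤ η) {β γ : ℝ} (hβ : 0 ≤ β) (hγ : 0 ≤ γ) {U : ℝ} (hU : 0 ≤ U) {V : ℝ}
    {H : GreedyState α → ℝ}
    (hH : ∀ st a b Δ, 0 ≤ Δ →
      P.Inv M f p O ((1 - P.δ) * U) a b Δ st.sampled st.accepted →
        V + β * (a - (1 - P.δ) ^ 2 * b) - γ * Δ ≤ H st)
    (st : GreedyState α) (a b Δ : ℝ) (hΔ : 0 ≤ Δ)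
    (hI : P.Inv M f p O U a b Δ st.sampled st.accepted) :
    V + β * (a - (1 - P.δ) ^ 2 * b) - γ * Δ - (P.R + 1 : ℕ) * P.roundLoss γ η ≤
      (P.level ((1 - P.δ) * U) st).expect (matchoidOracle M f) H := by
  classical
  rw [level, AdaptiveAlg.expect_bind, expect_probe]
  set st₀ : GreedyState α := ⟨st.sampled, st.accepted, Finset.univ⟩ with hst₀
  have hround : γ * 𝔼 ω : P.Samples, P.listError M f ω [] st.sampled ≤ P.roundLoss γ η := by
    rw [roundLoss]
    exact mul_le_mul_of_nonneg_left (expect_listError_le hη hη0 List.nodup_nil _) hγ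
  have hmain : ∀ ω : P.Samples,
      V + β * (a - (1 - P.δ) ^ 2 * b) - γ * Δ - P.R * P.roundLoss γ η -
        γ * P.listError M f ω [] st.sampled ≤
      (P.sweep ((1 - P.δ) * U) P.R (P.step (matchoidOracle M f) ((1 - P.δ) * U) ω [] st₀)).expect
        (matchoidOracle M f) H := by
    intro ω
    obtain ⟨h1, h2, h3⟩ := inv_step (lam := (1 - P.δ) * U) (st := st₀) hf hG hc hΔ hI ω
      List.nodup_nil (by simp) rfl
    have hC : CandsInv P M f ((1 - P.δ) * U) Δ st₀ := fun o _ h => absurd (Finset.mem_univ o) h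
    have h4 := candsInv_step hf hG hΔ hC ω rfl h2 h3
    have h5 := le_expect_sweep hf hG hc hp hM hO hδ0 hδ1 hη hη0 hβ hγ hU hH P.R _ _ _ _
      (add_nonneg hΔ (listError_nonneg ω [] st₀.sampled)) h1 h4
      (not_blocked_of_mem_cands_step hG _ ω [] st₀) (by
        have hle : (P.step (matchoidOracle M f) ((1 - P.δ) * U) ω [] st₀).cands.card ≤
          Fintype.card α := Finset.card_le_univ _
        rcases hR with hR | hR
        · exact Or.inl (hle.trans hR)
        · refine Or.inr (lt_of_le_of_lt ?_ hR)
          have : 0 ≤ 1 - P.δ := by linarith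
          gcongr)
    refine le_trans (le_of_eq ?_) h5
    have e1 : (P.step (matchoidOracle M f) ((1 - P.δ) * U) ω [] st₀).accepted = st.accepted := rfl
    have e2 : (P.step (matchoidOracle M f) ((1 - P.δ) * U) ω [] st₀).sampled = st.sampled := rfl
    rw [e1, e2]
    simp only [hst₀]
    ring
  refine le_trans ?_ (Finset.expect_le_expect fun ω _ => hmain ω)
  rw [Finset.expect_sub_distrib, Fintype.expect_const, ← Finset.mul_expect]
  push_cast
  linarith

theorem le_expect_levels (hf : IsMonotoneSubmodular f) (hG : M.groundSet = P.ground)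
    (hc : ∀ e, P.c e < P.K) (hp : 1 ≤ p) (hM : M.IsPMatchoid p) (hO : M.Indep O)
    (hδ0 : 0 < P.δ) (hδ1 : P.δ < 1) (hR : P.Exhausts P.R (Fintype.card α)) {η : ℝ}
    (hη : ∀ T e, ¬ M.Blocked T e → 𝔼 ω : P.Samples, |P.estimate f ω T e - P.gain f T e| ≤ η)
    (hη0 : 0 ≤ η) {β γ : ℝ} (hβ : 0 ≤ β) (hγ : 0 ≤ γ) {V : ℝ} {H : GreedyState α → ℝ}
    (L : ℕ) {U : ℝ} (hU : 0 ≤ U)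
    (hH : ∀ st a b Δ, 0 ≤ Δ →
      P.Inv M f p O ((1 - P.δ) ^ L * U) a b Δ st.sampled st.accepted →
        V + β * (a - (1 - P.δ) ^ 2 * b) - γ * Δ ≤ H st)
    (st : GreedyState α) (a b Δ : ℝ) (hΔ : 0 ≤ Δ)
    (hI : P.Inv M f p O U a b Δ st.sampled st.accepted) :
    V + β * (a - (1 - P.δ) ^ 2 * b) - γ * Δ - (L * (P.R + 1) : ℕ) * P.roundLoss γ η ≤
      (P.levels L U st).expect (matchoidOracle M f) H := by
  induction L generalizing U st a b Δ with
  | zero =>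
    rw [pow_zero, one_mul] at hH
    simp only [zero_mul, Nat.cast_zero, sub_zero, levels, AdaptiveAlg.expect]
    exact hH st a b Δ hΔ hI
  | succ L ih =>
    rw [levels, AdaptiveAlg.expect_bind]
    have hU' : 0 ≤ (1 - P.δ) * U := mul_nonneg (by linarith) hU
    have h1 := le_expect_level (V := V - (L * (P.R + 1) : ℕ) * P.roundLoss γ η)
      (H := fun st => (P.levels L ((1 - P.δ) * U) st).expect (matchoidOracle M f) H)
      hf hG hc hp hM hO hδ0 hδ1 hR hη hη0 hβ hγ hU
      (fun st a b Δ hΔ hI => by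
        refine le_trans (le_of_eq ?_) (ih hU' (fun st a b Δ hΔ hI => ?_) st a b Δ hΔ hI)
        · ring
        · refine hH st a b Δ hΔ ?_
          rwa [pow_succ, mul_assoc]) st a b Δ hΔ hI
    refine le_trans (le_of_eq ?_) h1
    push_cast
    ring

/-- The expected gain of the parallel greedy algorithm. -/
theorem le_expect_greedy (hf : IsMonotoneSubmodular f) (hG : M.groundSet = P.ground)
    (hc : ∀ e, P.c e < P.K) (hp : 1 ≤ p) (hM : M.IsPMatchoid p) (hO : M.Indep O)
    (hδ0 : 0 < P.δ) (hδ1 : P.δ < 1) (hR : P.Exhausts P.R (Fintype.card α)) {η : ℝ}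
    (hη : ∀ T e, ¬ M.Blocked T e → 𝔼 ω : P.Samples, |P.estimate f ω T e - P.gain f T e| ≤ η)
    (hη0 : 0 ≤ η) {Λ : ℝ} (hΛ0 : 0 ≤ Λ) (hΛ : ∀ e, ¬ M.Blocked ∅ e → f {e} ≤ Λ) (L : ℕ)
    {β V : ℝ} (hβ : 0 ≤ β) {h : Finset α → ℝ}
    (hh : ∀ S, V + β * (P.K * (P.value f S - P.value f ∅)) ≤ h S) :
    V + β * ((1 - P.δ) ^ 2 / (p + 1 / P.K) *
        (f O - P.value f ∅ - Fintype.card α * ((1 - P.δ) ^ L * Λ)) -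
      (L * (P.R + 1) : ℕ) * P.roundLoss (3 * Fintype.card α) η) ≤
      (P.greedy L Λ).expect (matchoidOracle M f) h := by
  rw [greedy, AdaptiveAlg.expect_bind]
  have hθ0 : 0 ≤ (1 - P.δ) ^ 2 := sq_nonneg _
  have hθ1 : (1 - P.δ) ^ 2 ≤ 1 := pow_le_one₀ (by linarith) (by linarith)
  have hγ : 0 ≤ β * (3 * (Fintype.card α : ℝ)) := by positivity
  have h1 := le_expect_levels (γ := β * (3 * Fintype.card α))
    (V := V + β * ((1 - P.δ) ^ 2 / (p + 1 / P.K) *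
        (f O - P.value f ∅ - Fintype.card α * ((1 - P.δ) ^ L * Λ))))
    (H := fun st => h st.accepted) hf hG hc hp hM hO hδ0 hδ1 hR hη hη0 hβ hγ L hΛ0
    (fun st a b Δ hΔ hI => by
      have hU : 0 ≤ (1 - P.δ) ^ L * Λ := mul_nonneg (pow_nonneg (by linarith) _) hΛ0
      have h2 := hI.final hf hp hM hO hθ0 hθ1 hU hΔ
      refine le_trans ?_ (hh st.accepted)
      have h3 := mul_le_mul_of_nonneg_left h2 hβ
      linarith) ⟨∅, ∅, ∅⟩ 0 0 0 le_rfl (inv_empty hf hp hM hO hΛ)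
  refine le_trans (le_of_eq ?_) h1
  simp only [roundLoss]
  ring

omit [Fintype ι] in
/-- With `K = 1`, the estimates are exact. -/
theorem estimate_eq_gain_of_K_eq_one (hK : P.K = 1) (ω : P.Samples) (T : Finset α) (e : α) :
    P.estimate f ω T e = P.gain f T e := by
  have hs : Subsingleton (Fin P.K) := by rw [hK]; infer_instance
  have hne : Nonempty (Fin P.K) := ⟨⟨0, P.K_pos⟩⟩
  have hne' : Nonempty (Fin P.M) := ⟨⟨0, P.M_pos⟩⟩
  have h : ∀ u u' : α → Fin P.K, sampleGain f (bump P.c T) e u = sampleGain f (bump P.c T) e u' :=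
    fun u u' => by rw [Subsingleton.elim u u']
  have u₀ : α → Fin P.K := Classical.arbitrary _
  rw [estimate, gain, meanGain]
  simp only [fun u => h u u₀, Fintype.expect_const]

omit [Fintype ι] in
-- An element not blocked by `T` is not blocked by `∅`, so its sampled gains lie in `[0, Λ]`.
theorem expect_abs_estimate_sub_le (hf : IsMonotoneSubmodular f) {Λ : ℝ}
    (hΛ : ∀ e, ¬ M.Blocked ∅ e → f {e} ≤ Λ) (T : Finset α) (e : α) (he : ¬ M.Blocked T e) :
    𝔼 ω : P.Samples, |P.estimate f ω T e - P.gain f T e| ≤ Λ / Real.sqrt P.M := by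
  have hne : Nonempty (Fin P.K) := ⟨⟨0, P.K_pos⟩⟩
  have he' : f {e} ≤ Λ := hΛ e fun hb => he (hb.mono (Finset.empty_subset _))
  exact expect_abs_sampleMean_sub_le (fun u => sampleGain f (bump P.c T) e u)
    (fun u => ⟨sampleGain_nonneg hf _ _ _, (sampleGain_le hf _ _ _).trans he'⟩) P.M_pos

end GreedyParams

/-! ### The largest value of a single element -/

section Singletons
variable {α ι : Type*} [Fintype α] [DecidableEq α]

open Classical in
/-- The largest value of an element that is not blocked by the empty set. -/
noncomputable def maxSingleton (G : ι → Set α) (ans : MatchoidQuery α ι → ℝ) : ℝ :=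
  -- The inserted `0` provides a maximum even if every element is blocked.
  (insert 0 ((Finset.univ.filter fun e => ¬ BlockedBy G ans ∅ e).image fun e =>
    ans (.value {e}))).max' (Finset.insert_nonempty _ _)

variable {M : Matchoid α ι} {f : Finset α → ℝ} {G : ι → Set α}

theorem maxSingleton_nonneg (ans : MatchoidQuery α ι → ℝ) : 0 ≤ maxSingleton G ans := by
  classical
  rw [maxSingleton]
  refine Finset.le_max' _ _ ?_
  exact Finset.mem_insert_self _ _

theorem le_maxSingleton (hG : M.groundSet = G) (e : α) (he : ¬ M.Blocked ∅ e) :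
    f {e} ≤ maxSingleton G (matchoidOracle M f) := by
  classical
  rw [maxSingleton]
  refine Finset.le_max' _ _ ?_
  refine Finset.mem_insert_of_mem (Finset.mem_image.2 ⟨e, ?_, rfl⟩)
  rw [Finset.mem_filter, blockedBy_oracle_iff hG]
  exact ⟨Finset.mem_univ _, he⟩

theorem maxSingleton_le_opt (hf : IsMonotoneSubmodular f) (hG : M.groundSet = G) :
    maxSingleton G (matchoidOracle M f) ≤ M.opt f := by
  classical
  refine Finset.max'_le _ _ _ fun y hy => ?_
  rw [Finset.mem_insert, Finset.mem_image] at hy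
  rcases hy with rfl | ⟨e, he, rfl⟩
  · exact (hf.nonneg ∅).trans ((M.isGreatest_opt f).2 ⟨∅, M.indep_empty, rfl⟩)
  · rw [Finset.mem_filter, blockedBy_oracle_iff hG] at he
    exact (M.isGreatest_opt f).2 ⟨{e}, Matchoid.indep_singleton he.2, rfl⟩

variable [Fintype ι]

variable (α ι) in
open Classical in
/-- The queries that determine the values of the single elements. -/
noncomputable def singletonQueries : Finset (MatchoidQuery α ι) :=
  (Finset.univ : Finset (α × (Unit ⊕ (ι × Bool)))).image fun x =>
    match x with
    | (e, .inl _) => .value {e}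
    | (e, .inr (i, b)) => .rank i (if b then insert e ∅ else ∅)

/-- Determine the largest value of a single element in one round. -/
noncomputable def findMaxSingleton (G : ι → Set α) : AdaptiveAlg (MatchoidQuery α ι) ℝ ℝ :=
  (AdaptiveAlg.ask (singletonQueries α ι)).bind fun ans => .output (maxSingleton G ans)

theorem maxSingleton_congr {ans ans' : MatchoidQuery α ι → ℝ}
    (h : ∀ q ∈ singletonQueries α ι, ans q = ans' q) :
    maxSingleton G ans = maxSingleton G ans' := by
  classical
  have h1 : ∀ e : α, ans (.value {e}) = ans' (.value {e}) := fun e =>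
    h _ (Finset.mem_image.2 ⟨(e, .inl ()), Finset.mem_univ _, rfl⟩)
  have h2 : ∀ i, ∀ e : α, ans (.rank i (insert e ∅)) = ans' (.rank i (insert e ∅)) := fun i e =>
    h _ (Finset.mem_image.2 ⟨(e, .inr (i, true)), Finset.mem_univ _, rfl⟩)
  have h3 : ∀ i, ∀ _ : α, ans (.rank i ∅) = ans' (.rank i ∅) := fun i e =>
    h _ (Finset.mem_image.2 ⟨(e, .inr (i, false)), Finset.mem_univ _, rfl⟩)
  have h4 : ∀ e, BlockedBy G ans ∅ e ↔ BlockedBy G ans' ∅ e := fun e => by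
    simp only [BlockedBy, h2, fun i => h3 i e]
  simp only [maxSingleton, h1, h4]

theorem expect_findMaxSingleton (oracle : MatchoidQuery α ι → ℝ) (h : ℝ → ℝ) :
    (findMaxSingleton G).expect oracle h = h (maxSingleton G oracle) := by
  rw [findMaxSingleton, AdaptiveAlg.expect_bind, AdaptiveAlg.expect_ask, AdaptiveAlg.expect,
    maxSingleton_congr (ans' := oracle)]
  intro q hq
  rw [if_pos hq]

theorem ensures_findMaxSingleton (oracle : MatchoidQuery α ι → ℝ) {N : ℝ}
    (hN : (Fintype.card α : ℝ) * (1 + 2 * Fintype.card ι) ≤ N) :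
    (findMaxSingleton G).Ensures oracle N (fun x => x = maxSingleton G oracle) 1 := by
  classical
  refine AdaptiveAlg.Ensures.bind (s := 0) (k := fun ans => .output (maxSingleton G ans))
    (P' := fun x => x = maxSingleton G oracle) (fun ans hans => maxSingleton_congr hans)
    (AdaptiveAlg.ensures_ask oracle _ (le_trans ?_ hN))
  have h1 : (singletonQueries α ι).card ≤ Fintype.card α * (1 + 2 * Fintype.card ι) := by
    refine Finset.card_image_le.trans_eq ?_
    simp only [Finset.card_univ, Fintype.card_prod, Fintype.card_sum, Fintype.card_unit,
      Fintype.card_bool]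
    ring
  exact_mod_cast h1

end Singletons

/-! ### Convex combinations with equal weights -/

section Weights
variable {α ι : Type*} [Fintype α] [DecidableEq α]

/-- The weights of the convex combination that gives weight `1 / K` to every entry of a list. -/
noncomputable def listWeights (K : ℕ) (hist : List (Finset α)) (S : Finset α) : ℝ :=
  hist.count S / K

/-- The number of entries of a list that contain `e`. -/
def coverCount (hist : List (Finset α)) (e : α) : ℕ :=
  hist.countP fun S => e ∈ S

omit [Fintype α] in
theorem bump_coverCount (hist : List (Finset α)) (S : Finset α) :
    bump (coverCount hist) S = coverCount (S :: hist) := by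
  ext e
  simp [bump, coverCount, List.countP_cons]

omit [Fintype α] in
theorem coverCount_le (hist : List (Finset α)) (e : α) : coverCount hist e ≤ hist.length :=
  List.countP_le_length

theorem pointOfWeights_listWeights (K : ℕ) (hist : List (Finset α)) :
    pointOfWeights (listWeights K hist) = fun e => (coverCount hist e : ℝ) / K := by
  ext e
  have h : ∑ S : Finset α, (if e ∈ S then (hist.count S : ℝ) else 0) = coverCount hist e := by
    induction hist with
    | nil => simp [coverCount]
    | cons T hist ih =>
      have h1 : ∀ S : Finset α, (if e ∈ S then ((T :: hist).count S : ℝ) else 0) =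
          (if e ∈ S then (hist.count S : ℝ) else 0) + if S = T then (if e ∈ S then 1 else 0) else 0 := by
        intro S
        rw [List.count_cons]
        by_cases h2 : S = T
        · subst h2
          by_cases he : e ∈ S <;> simp [he]
        · have : ¬ T = S := fun h => h2 h.symm
          split_ifs <;> simp_all
      simp only [h1]
      rw [Finset.sum_add_distrib, ih, Finset.sum_ite_eq' Finset.univ T]
      simp [coverCount, List.countP_cons]
  rw [pointOfWeights, ← h, Finset.sum_div]
  refine Finset.sum_congr rfl fun S _ => ?_
  rw [listWeights]
  split_ifs <;> simp

theorem isConvexCombination_listWeights {M : Matchoid α ι} {K : ℕ} (hK : 0 < K)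
    {hist : List (Finset α)} (hlen : hist.length = K) (hI : ∀ S ∈ hist, M.Indep S) :
    M.IsConvexCombination (listWeights K hist) where
  nonneg := fun S => by rw [listWeights]; positivity
  sum_eq_one := by
    have h : ∑ S : Finset α, hist.count S = hist.length := by
      have := Multiset.sum_count_eq_card (s := Finset.univ) (m := (hist : Multiset (Finset α)))
        fun a _ => Finset.mem_univ a
      simpa using this
    have hK' : (K : ℝ) ≠ 0 := by positivity
    simp only [listWeights]
    rw [← Finset.sum_div, div_eq_one_iff_eq hK', ← hlen, ← h]
    push_cast
    rfl
  indep := fun S hS => by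
    refine hI S (List.count_pos_iff.1 (Nat.pos_of_ne_zero fun h => hS ?_))
    simp [listWeights, h]

omit [Fintype α] in
theorem ncard_listWeights_le (K : ℕ) (hist : List (Finset α)) :
    {S | listWeights K hist S ≠ 0}.ncard ≤ hist.length := by
  have hsub : {S | listWeights K hist S ≠ 0} ⊆ (hist.toFinset : Set (Finset α)) := by
    intro S hS
    rw [Finset.mem_coe, List.mem_toFinset]
    refine List.count_pos_iff.1 (Nat.pos_of_ne_zero fun h => hS ?_)
    simp [listWeights, h]
  refine (Set.ncard_le_ncard hsub (Finset.finite_toSet _)).trans ?_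
  rw [Set.ncard_coe_finset]
  exact List.toFinset_card_le _

end Weights

/-! ### The algorithm for the multilinear extension -/

section Phases
variable {α ι : Type*} [Fintype α] [DecidableEq α] [Fintype ι]

/-- Run the parallel greedy algorithm repeatedly, each time from the point reached so far. -/
noncomputable def phases (P : GreedyParams α ι) (L : ℕ) (Λ : ℝ) :
    ℕ → List (Finset α) → AdaptiveAlg (MatchoidQuery α ι) ℝ (Finset α → ℝ)
  | 0, hist => .output (listWeights P.K hist)
  | j + 1, hist => (GreedyParams.greedy { P with c := coverCount hist } L Λ).bind fun S =>
      phases P L Λ j (S :: hist)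

variable {P : GreedyParams α ι} {M : Matchoid α ι} {f : Finset α → ℝ}

theorem ensures_phases (hG : M.groundSet = P.ground) (L : ℕ) (Λ : ℝ) (j : ℕ)
    {hist : List (Finset α)} (hlen : hist.length + j = P.K) (hI : ∀ S ∈ hist, M.Indep S) :
    (phases P L Λ j hist).Ensures (matchoidOracle M f) P.queryBound
      (fun w => M.IsConvexCombination w ∧ {S | w S ≠ 0}.ncard ≤ P.K) (j * (L * (P.R + 1))) := by
  induction j generalizing hist with
  | zero =>
    rw [add_zero] at hlen
    exact ⟨isConvexCombination_listWeights P.K_pos hlen hI,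
      (ncard_listWeights_le _ _).trans_eq hlen⟩
  | succ j ih =>
    rw [phases, Nat.succ_mul, add_comm]
    refine AdaptiveAlg.Ensures.bind (fun S hS => ih ?_ ?_)
      (GreedyParams.ensures_greedy (P := { P with c := coverCount hist }) hG L Λ)
    · rw [List.length_cons]
      omega
    · intro T hT
      rcases List.mem_cons.1 hT with rfl | hT
      · exact hS
      · exact hI T hT

/-- A phase multiplies the expected gap to `f O` by at most `1 - q / K`, where `q = (1 - δ) ^ 2 / (p
+ 1 / K)`, up to an additive `2 * δ * f O / K`. One `δ * f O` covers the gains below the last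
threshold (`hL`), the other the estimation errors (`hM'`). -/
theorem le_expect_phases {p : ℕ} {O : Finset α} (hf : IsMonotoneSubmodular f)
    (hG : M.groundSet = P.ground) (hp : 1 ≤ p) (hM : M.IsPMatchoid p) (hO : M.Indep O)
    (hδ0 : 0 < P.δ) (hδ1 : P.δ < 1) (hR : P.Exhausts P.R (Fintype.card α))
    {Λ : ℝ} (hΛ0 : 0 ≤ Λ) (hΛ : ∀ e, ¬ M.Blocked ∅ e → f {e} ≤ Λ) (hΛO : Λ ≤ f O) (L : ℕ)
    (hL : Fintype.card α * (1 - P.δ) ^ L ≤ P.δ)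
    (hM' : ((L * (P.R + 1) : ℕ) : ℝ) * (3 * Fintype.card α * ((Fintype.card α + 1) *
      Fintype.card α)) ≤ P.δ * Real.sqrt P.M)
    (j : ℕ) {hist : List (Finset α)} (hlen : hist.length + j = P.K) :
    f O - (1 - (1 - P.δ) ^ 2 / (p + 1 / P.K) / P.K) ^ j *
        (f O - gridValue f P.K (coverCount hist)) - j * (2 * P.δ * f O / P.K) ≤
      (phases P L Λ j hist).expect (matchoidOracle M f)
        fun w => multilinearExtension f (pointOfWeights w) := by
  have hK : (0 : ℝ) < P.K := by exact_mod_cast P.K_pos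
  have hK1 : (1 : ℝ) ≤ P.K := by exact_mod_cast P.K_pos
  have hp' : (1 : ℝ) ≤ p := by exact_mod_cast hp
  have hκ : (1 : ℝ) ≤ p + 1 / P.K := by
    have : 0 ≤ 1 / (P.K : ℝ) := by positivity
    linarith
  have hθ1 : (1 - P.δ) ^ 2 ≤ 1 := pow_le_one₀ (by linarith) (by linarith)
  set q := (1 - P.δ) ^ 2 / (p + 1 / P.K) with hq
  have hq0 : 0 ≤ q := by positivity
  have hq1 : q ≤ 1 := div_le_one_of_le₀ (by linarith) (by linarith)
  have hρ0 : 0 ≤ 1 - q / P.K := by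
    rw [sub_nonneg]
    exact div_le_one_of_le₀ (by linarith) hK.le
  have hρ1 : 1 - q / P.K ≤ 1 := by
    have : 0 ≤ q / P.K := by positivity
    linarith
  have hMpos : (0 : ℝ) < P.M := by exact_mod_cast P.M_pos
  have hsq : 0 < Real.sqrt P.M := Real.sqrt_pos.2 hMpos
  induction j generalizing hist with
  | zero =>
    simp only [phases, AdaptiveAlg.expect, pointOfWeights_listWeights,
      multilinearExtension_grid f P.K_pos]
    simp
  | succ j ih =>
    rw [phases, AdaptiveAlg.expect_bind]
    set P' : GreedyParams α ι := { P with c := coverCount hist } with hP'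
    have hc : ∀ e, P'.c e < P'.K := fun e => by
      have := coverCount_le hist e
      change coverCount hist e < P.K
      omega
    have hv0 : P'.value f ∅ = gridValue f P.K (coverCount hist) := by
      rw [GreedyParams.value, bump_empty]
    have hv : ∀ S, P'.value f S = gridValue f P.K (coverCount (S :: hist)) := fun S => by
      rw [GreedyParams.value, ← bump_coverCount]
    set ρ := 1 - q / P.K with hρ
    have hρj0 : 0 ≤ ρ ^ j := pow_nonneg hρ0 _
    have hρj1 : ρ ^ j ≤ 1 := pow_le_one₀ hρ0 hρ1
    -- `β` and `V` are chosen so that the payoff bound, affine in the value reached by this phase,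
    -- is exactly the induction hypothesis for the remaining `j` phases.
    have h1 := GreedyParams.le_expect_greedy (P := P') (O := O) (β := ρ ^ j / P.K)
      (V := f O - ρ ^ j * (f O - P'.value f ∅) - j * (2 * P.δ * f O / P.K))
      (h := fun S => (phases P L Λ j (S :: hist)).expect (matchoidOracle M f)
        fun w => multilinearExtension f (pointOfWeights w))
      hf hG hc hp hM hO hδ0 hδ1 hR
      (GreedyParams.expect_abs_estimate_sub_le hf hΛ) (by positivity) hΛ0 hΛ L (by positivity)
      (fun S => by
        refine le_trans (le_of_eq ?_) (ih (hist := S :: hist) (by rw [List.length_cons]; omega))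
        rw [← hv S]
        change _ + ρ ^ j / P.K * (P.K * _) = _
        field_simp
        ring)
    refine le_trans ?_ h1
    rw [← hv0]
    set g := P'.value f ∅
    have h2 : (Fintype.card α : ℝ) * ((1 - P.δ) ^ L * Λ) ≤ P.δ * f O := by
      calc (Fintype.card α : ℝ) * ((1 - P.δ) ^ L * Λ) = Fintype.card α * (1 - P.δ) ^ L * Λ := by
            ring
        _ ≤ P.δ * Λ := by gcongr
        _ ≤ P.δ * f O := by gcongr
    have h3 : ((L * (P.R + 1) : ℕ) : ℝ) * P'.roundLoss (3 * Fintype.card α) (Λ / Real.sqrt P.M) ≤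
        P.δ * f O := by
      calc ((L * (P.R + 1) : ℕ) : ℝ) * P'.roundLoss (3 * Fintype.card α) (Λ / Real.sqrt P.M)
          = ((L * (P.R + 1) : ℕ) : ℝ) * (3 * Fintype.card α * ((Fintype.card α + 1) *
      Fintype.card α)) * (Λ / Real.sqrt P.M) := by rw [GreedyParams.roundLoss]; ring
        _ ≤ P.δ * Real.sqrt P.M * (Λ / Real.sqrt P.M) := by gcongr
        _ = P.δ * Λ := by field_simp
        _ ≤ P.δ * f O := by gcongr
    have h4 : q * (Fintype.card α * ((1 - P.δ) ^ L * Λ)) ≤ P.δ * f O := by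
      refine le_trans ?_ h2
      have : 0 ≤ (Fintype.card α : ℝ) * ((1 - P.δ) ^ L * Λ) := by
        have : 0 ≤ 1 - P.δ := by linarith
        positivity
      nlinarith
    have hfO : 0 ≤ P.δ * f O := mul_nonneg hδ0.le (hf.nonneg O)
    have h5 : ρ ^ j / P.K * (2 * (P.δ * f O)) ≤ 1 / P.K * (2 * (P.δ * f O)) := by gcongr
    have h6 : ρ ^ j / P.K * (q * (f O - g) - 2 * (P.δ * f O)) ≤
        ρ ^ j / P.K * (q * (f O - g - Fintype.card α * ((1 - P.δ) ^ L * Λ)) -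
          ((L * (P.R + 1) : ℕ) : ℝ) * P'.roundLoss (3 * Fintype.card α) (Λ / Real.sqrt P.M)) := by
      gcongr ρ ^ j / P.K * ?_
      linarith
    have h7 : ρ ^ (j + 1) * (f O - g) = ρ ^ j * (f O - g) - ρ ^ j / P.K * (q * (f O - g)) := by
      rw [pow_succ, hρ]
      ring
    rw [h7]
    have h8 : ((j + 1 : ℕ) : ℝ) * (2 * P.δ * f O / P.K) =
        j * (2 * P.δ * f O / P.K) + 1 / P.K * (2 * (P.δ * f O)) := by
      push_cast
      ring
    rw [h8]
    change _ ≤ _ + ρ ^ j / P.K * (q * (f O - g - Fintype.card α * ((1 - P.δ) ^ L * Λ)) -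
          ((L * (P.R + 1) : ℕ) : ℝ) * P'.roundLoss (3 * Fintype.card α) (Λ / Real.sqrt P.M))
    linarith

end Phases

/-! ### The choice of the parameters -/

section Numerics

/-- The number of rounds per threshold. -/
noncomputable def sweepRounds (n : ℕ) (δ : ℝ) : ℕ := min n (⌈Real.log n / δ⌉₊ + 1)

/-- The number of thresholds. -/
noncomputable def thresholdCount (n : ℕ) (δ : ℝ) : ℕ := ⌈Real.log (n / δ) / δ⌉₊

theorem one_sub_pow_le_exp {δ : ℝ} (hδ1 : δ ≤ 1) (k : ℕ) :
    (1 - δ) ^ k ≤ Real.exp (-(δ * k)) := by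
  calc (1 - δ) ^ k ≤ Real.exp (-δ) ^ k :=
        pow_le_pow_left₀ (by linarith) (Real.one_sub_le_exp_neg δ) k
    _ = Real.exp (-(δ * k)) := by rw [← Real.exp_nat_mul]; ring_nf

theorem card_mul_pow_thresholdCount_le {n : ℕ} (hn : 0 < n) {δ : ℝ} (hδ0 : 0 < δ) (hδ1 : δ ≤ 1) :
    n * (1 - δ) ^ thresholdCount n δ ≤ δ := by
  have hn' : (0 : ℝ) < n := by exact_mod_cast hn
  have h1 : Real.log (n / δ) ≤ δ * thresholdCount n δ := by
    have := Nat.le_ceil (Real.log (n / δ) / δ)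
    rw [div_le_iff₀ hδ0] at this
    rw [mul_comm]
    exact this
  calc n * (1 - δ) ^ thresholdCount n δ ≤ n * Real.exp (-(δ * thresholdCount n δ)) := by
        gcongr
        exact one_sub_pow_le_exp hδ1 _
    _ ≤ n * Real.exp (-Real.log (n / δ)) := by gcongr
    _ = δ := by
        rw [Real.exp_neg, Real.exp_log (by positivity)]
        field_simp

theorem le_sweepRounds_or {n : ℕ} (hn : 0 < n) {δ : ℝ} (hδ0 : 0 < δ) (hδ1 : δ ≤ 1) :
    n ≤ sweepRounds n δ ∨ (1 - δ) ^ sweepRounds n δ * n < 1 := by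
  have hn' : (0 : ℝ) < n := by exact_mod_cast hn
  rcases le_total n (⌈Real.log n / δ⌉₊ + 1) with h | h
  · exact Or.inl (le_min le_rfl h)
  · right
    rw [sweepRounds, min_eq_right h]
    -- The extra `+ 1` in `sweepRounds` makes this strict, so that fewer than one candidate remains.
    have h1 : Real.log n < δ * (⌈Real.log n / δ⌉₊ + 1 : ℕ) := by
      have := Nat.le_ceil (Real.log n / δ)
      rw [div_le_iff₀ hδ0] at this
      push_cast
      nlinarith
    calc (1 - δ) ^ (⌈Real.log n / δ⌉₊ + 1) * n
        ≤ Real.exp (-(δ * (⌈Real.log n / δ⌉₊ + 1 : ℕ))) * n := by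
          gcongr
          exact one_sub_pow_le_exp hδ1 _
      _ < Real.exp (-Real.log n) * n := by gcongr
      _ = 1 := by
          rw [Real.exp_neg, Real.exp_log hn']
          field_simp

theorem half_lt_log {n : ℕ} (hn : 2 ≤ n) : 69 / 100 < Real.log n := by
  have h1 : Real.log 2 ≤ Real.log n :=
    Real.log_le_log (by norm_num) (by exact_mod_cast hn)
  have := Real.log_two_gt_d9
  linarith

/-- The number of thresholds contains `log (1 / δ)`, which must not survive in the bound. If `δ ≥ 1
/ n`, it is at most `log n`. If `δ ≤ 1 / n`, the cap of `n` sweeps per threshold takes over, and `n`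
is at most `1 / δ`. -/
theorem thresholdCount_mul_sweepRounds_le {n : ℕ} (hn : 2 ≤ n) {δ : ℝ} (hδ0 : 0 < δ)
    (hδ1 : δ ≤ 1) :
    ((thresholdCount n δ * (sweepRounds n δ + 1) : ℕ) : ℝ) ≤ 28 * Real.log n ^ 2 / δ ^ 2 := by
  have hn' : (2 : ℝ) ≤ n := by exact_mod_cast hn
  have hn0 : (0 : ℝ) < n := by linarith
  have hlog := half_lt_log hn
  set l := Real.log n with hl
  have hld : Real.log (n / δ) = l + Real.log (1 / δ) := by
    rw [div_eq_mul_one_div, Real.log_mul (by positivity) (by positivity)]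
  have hldinv : 0 ≤ Real.log (1 / δ) := Real.log_nonneg (by rw [le_div_iff₀ hδ0]; linarith)
  have hceil : (thresholdCount n δ : ℝ) < Real.log (n / δ) / δ + 1 :=
    Nat.ceil_lt_add_one (by rw [hld]; positivity)
  have hldiv : l ≤ l / δ := by
    rw [le_div_iff₀ hδ0]
    nlinarith
  push_cast
  rcases le_total (1 / n : ℝ) δ with h | h
  · have h1 : Real.log (1 / δ) ≤ l := by
      refine Real.log_le_log (by positivity) ?_
      rw [div_le_iff₀ hδ0]
      rw [div_le_iff₀ hn0] at h
      linarith
    have h2 : Real.log (n / δ) / δ ≤ 2 * (l / δ) := by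
      rw [hld, ← mul_div_assoc]
      gcongr
      linarith
    have h3 : (thresholdCount n δ : ℝ) ≤ 4 * (l / δ) := by linarith
    have h4 : (sweepRounds n δ : ℝ) ≤ l / δ + 2 := by
      have h5 : sweepRounds n δ ≤ ⌈l / δ⌉₊ + 1 := min_le_right _ _
      have h6 : ((sweepRounds n δ : ℕ) : ℝ) ≤ (⌈l / δ⌉₊ + 1 : ℕ) := by exact_mod_cast h5
      have h7 : (⌈l / δ⌉₊ : ℝ) < l / δ + 1 := Nat.ceil_lt_add_one (by positivity)
      push_cast at h6
      linarith
    have h5 : (sweepRounds n δ : ℝ) + 1 ≤ 7 * (l / δ) := by linarith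
    calc (thresholdCount n δ : ℝ) * (sweepRounds n δ + 1) ≤ 4 * (l / δ) * (7 * (l / δ)) := by
          gcongr
      _ = 28 * l ^ 2 / δ ^ 2 := by ring
  · have hnδ : n * δ ≤ 1 := by
      rw [le_div_iff₀ hn0] at h
      linarith
    -- The term `1 / (n * δ)` is harmless: multiplied by `n / δ`, from the cap and the division by
    -- `δ`, it becomes `1 / δ ^ 2`.
    have h1 : Real.log (1 / δ) ≤ l + 1 / (n * δ) := by
      have e : (1 : ℝ) / δ = n * (1 / (n * δ)) := by field_simp
      rw [e, Real.log_mul (by positivity) (by positivity)]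
      have := Real.log_le_sub_one_of_pos (x := 1 / (n * δ)) (by positivity)
      linarith
    have h2 : (sweepRounds n δ : ℝ) + 1 ≤ 2 * n := by
      have h5 : sweepRounds n δ ≤ n := min_le_left _ _
      have h6 : (sweepRounds n δ : ℝ) ≤ n := by exact_mod_cast h5
      linarith
    have h3 : (thresholdCount n δ : ℝ) ≤ (2 * l + 1 / (n * δ)) / δ + 1 := by
      have h4 : l + Real.log (1 / δ) ≤ 2 * l + 1 / (n * δ) := by linarith
      have h5 := div_le_div_of_nonneg_right h4 hδ0.le
      rw [← hld] at h5
      linarith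
    calc (thresholdCount n δ : ℝ) * (sweepRounds n δ + 1)
        ≤ ((2 * l + 1 / (n * δ)) / δ + 1) * (2 * n) := by gcongr
      _ = (4 * l * (n * δ) + 2 + 2 * (n * δ) * δ) / δ ^ 2 := by field_simp; ring
      _ ≤ 28 * l ^ 2 / δ ^ 2 := by
          gcongr
          have h4 : 4 * l * (n * δ) ≤ 4 * l * 1 := by gcongr
          have h5 : 2 * (n * δ) * δ ≤ 2 * 1 * 1 := by gcongr
          nlinarith

theorem one_le_log_sq_div {n : ℕ} (hn : 2 ≤ n) {δ : ℝ} (hδ0 : 0 < δ) (hδ1 : δ ≤ 1) (k : ℕ) :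
    1 ≤ 3 * Real.log n ^ 2 / δ ^ k := by
  have hlog := half_lt_log hn
  rw [le_div_iff₀ (by positivity)]
  have : δ ^ k ≤ 1 := pow_le_one₀ hδ0.le hδ1
  nlinarith

/-- The number of samples per estimate. -/
noncomputable def sampleCount (n : ℕ) (δ : ℝ) : ℕ :=
  -- A perfect square, so that its root in the error bound is exact; the base is the total weight of
  -- the errors over all rounds, divided by `δ`.
  (⌈((thresholdCount n δ * (sweepRounds n δ + 1) : ℕ) : ℝ) * (3 * n * ((n + 1) * n)) / δ⌉₊ + 1) ^ 2

theorem le_mul_sqrt_sampleCount (n : ℕ) {δ : ℝ} (hδ0 : 0 < δ) :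
    ((thresholdCount n δ * (sweepRounds n δ + 1) : ℕ) : ℝ) * (3 * n * ((n + 1) * n)) ≤
      δ * Real.sqrt (sampleCount n δ) := by
  rw [sampleCount]
  set x := ((thresholdCount n δ * (sweepRounds n δ + 1) : ℕ) : ℝ) * (3 * n * ((n + 1) * n)) with hx
  have h := Nat.le_ceil (x / δ)
  rw [div_le_iff₀ hδ0] at h
  push_cast
  rw [Real.sqrt_sq (by positivity)]
  nlinarith

theorem sampleCount_le {n : ℕ} (hn : 2 ≤ n) {ε Y : ℝ} (hε0 : 0 < ε) (hε1 : ε < 1) (hnY : n ≤ Y)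
    (hεY : 1 / ε ≤ Y) : (sampleCount n (ε / 5) : ℝ) ≤ 21002 ^ 2 * Y ^ 16 := by
  have hn' : (2 : ℝ) ≤ n := by exact_mod_cast hn
  have hY : 1 ≤ Y := by linarith
  have hlog := half_lt_log hn
  have hlogn : Real.log n ≤ Y := (Real.log_le_self (by linarith)).trans hnY
  have h1 := thresholdCount_mul_sweepRounds_le hn (δ := ε / 5) (by linarith) (by linarith)
  set t := ((thresholdCount n (ε / 5) * (sweepRounds n (ε / 5) + 1) : ℕ) : ℝ) with ht
  have h2 : t ≤ 700 * Y ^ 4 := by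
    calc t ≤ 28 * Real.log n ^ 2 / (ε / 5) ^ 2 := h1
      _ = 700 * Real.log n ^ 2 * (1 / ε) ^ 2 := by field_simp; ring
      _ ≤ 700 * Y ^ 2 * Y ^ 2 := by gcongr
      _ = 700 * Y ^ 4 := by ring
  have ht0 : 0 ≤ t := by positivity
  have h3 : t * (3 * n * ((n + 1) * n)) / (ε / 5) ≤ 21000 * Y ^ 8 := by
    calc t * (3 * n * ((n + 1) * n)) / (ε / 5) = t * (3 * n * ((n + 1) * n)) * (5 * (1 / ε)) := by
          field_simp
      _ ≤ 700 * Y ^ 4 * (3 * Y * ((Y + Y) * Y)) * (5 * Y) := by gcongr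
      _ = 21000 * Y ^ 8 := by ring
  have h4 := Nat.ceil_lt_add_one (a := t * (3 * n * ((n + 1) * n)) / (ε / 5)) (by positivity)
  have h5 : 1 ≤ Y ^ 8 := one_le_pow₀ hY
  rw [sampleCount, ← ht]
  push_cast
  calc ((⌈t * (3 * n * ((n + 1) * n)) / (ε / 5)⌉₊ : ℝ) + 1) ^ 2 ≤ (21002 * Y ^ 8) ^ 2 := by
        gcongr
        linarith
    _ = 21002 ^ 2 * Y ^ 16 := by ring

/-- The exponent changes by at most `3 * δ / p`, and `exp` has slope at most one on the nonpositive
reals. -/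
theorem exp_neg_div_le {p δ : ℝ} (hp : 1 ≤ p) (hδ0 : 0 ≤ δ) (hδ1 : 3 * δ ≤ 1) {k : ℝ} (hk0 : 0 ≤ k)
    (hk : k ≤ δ) :
    Real.exp (-((1 - δ) ^ 2 / (p + k))) ≤ Real.exp (-1 / p) + 3 * δ := by
  have h1 : (1 - 3 * δ) / p ≤ (1 - δ) ^ 2 / (p + k) := by
    rw [div_le_div_iff₀ (by linarith) (by linarith)]
    have h2 : (1 - 3 * δ) * (p + k) ≤ (1 - 3 * δ) * (p * (1 + δ)) := by
      gcongr
      nlinarith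
    have h3 : (1 - 3 * δ) * (1 + δ) ≤ (1 - δ) ^ 2 := by nlinarith
    nlinarith
  have h2 : Real.exp (-((1 - δ) ^ 2 / (p + k))) ≤ Real.exp (-((1 - 3 * δ) / p)) :=
    Real.exp_le_exp.2 (neg_le_neg h1)
  refine h2.trans ?_
  set x := -((1 - 3 * δ) / p) with hx
  have hx0 : x ≤ 0 := neg_nonpos.2 (div_nonneg (by linarith) (by linarith))
  have h3 : -1 / p = x - 3 * δ / p := by rw [hx]; ring
  have h4 := Real.add_one_le_exp (-(3 * δ / p))
  have h5 : Real.exp x ≤ 1 := Real.exp_le_one_iff.2 hx0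
  have h6 : 3 * δ / p ≤ 3 * δ := div_le_self (by linarith) hp
  have h7 : 0 ≤ 3 * δ / p := by positivity
  rw [h3, sub_eq_add_neg x, Real.exp_add]
  have h8 : 0 < Real.exp x := Real.exp_pos x
  nlinarith

end Numerics

theorem queryBound_le {α ι : Type*} [Fintype α] [Fintype ι] {P : GreedyParams α ι} {A Y : ℝ}
    (hY : 1 ≤ Y) (hn : Fintype.card α ≤ Y) (hm : Fintype.card ι ≤ Y)
    (hM : P.M ≤ A * Y ^ 16) : P.queryBound ≤ 4 * (A + 1) * Y ^ 18 := by
  have hY16 : Y ≤ Y ^ 16 := le_self_pow₀ hY (by norm_num)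
  rw [GreedyParams.queryBound]
  calc ((Fintype.card α : ℝ) + 1) * (Fintype.card α * (2 * (P.M + Fintype.card ι)))
      ≤ (Y + Y) * (Y * (2 * (A * Y ^ 16 + Y ^ 16))) := by
        gcongr
        exact hm.trans hY16
    _ = 4 * (A + 1) * Y ^ 18 := by ring

/-! ### Choice of constants and assembly of the two algorithms. -/

theorem mainTheorem3 :
    ∃ (C : ℝ) (d : ℕ), 0 < C ∧
      ∀ (α : Type*) (ι : Type*) [Fintype α] [DecidableEq α] [Fintype ι],
        2 ≤ Fintype.card α →
      ∀ (p : ℕ), 1 ≤ p →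
      ∀ (ε : ℝ), 0 < ε → ε < 1 →
      ∀ (G : ι → Set α),
        -- a randomized algorithm that computes an independent set
        (∃ alg : AdaptiveAlg (MatchoidQuery α ι) ℝ (Finset α),
          ∀ (M : Matchoid α ι) (f : Finset α → ℝ),
            M.groundSet = G → M.IsPMatchoid p → IsMonotoneSubmodular f →
            (∀ I ∈ (alg.run (matchoidOracle M f)).support, M.Indep I) ∧
            (1 - ε) / (p + 1) * M.opt f ≤
              expectation (alg.run (matchoidOracle M f)) f ∧
            alg.expectedRounds (matchoidOracle M f) ≤
              ENNReal.ofReal (C * Real.log (Fintype.card α) ^ 2 / ε ^ 2) ∧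
            alg.QueriesPerRoundLE (matchoidOracle M f)
              (C * (Fintype.card α + Fintype.card ι + 1 / ε) ^ d)) ∧
        -- a randomized algorithm that computes a convex combination of independent sets
        (∃ alg : AdaptiveAlg (MatchoidQuery α ι) ℝ (Finset α → ℝ),
          ∀ (M : Matchoid α ι) (f : Finset α → ℝ),
            M.groundSet = G → M.IsPMatchoid p → IsMonotoneSubmodular f →
            (∀ w ∈ (alg.run (matchoidOracle M f)).support,
              M.IsConvexCombination w ∧ ({S | w S ≠ 0}.ncard : ℝ) ≤ C / ε) ∧
            (1 - Real.exp (-1 / p) - ε) * M.opt f ≤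
              expectation (alg.run (matchoidOracle M f))
                (fun w => multilinearExtension f (pointOfWeights w)) ∧
            alg.expectedRounds (matchoidOracle M f) ≤
              ENNReal.ofReal (C * Real.log (Fintype.card α) ^ 2 / ε ^ 3) ∧
            alg.QueriesPerRoundLE (matchoidOracle M f)
              (C * (Fintype.card α + Fintype.card ι + 1 / ε) ^ d)) := by
  -- Both numbers come from the query bound: `sampleCount_le` with `Y ^ 16`, and two more factors of
  -- order `Y` in `queryBound_le`.
  refine ⟨4 * (21002 ^ 2 + 1), 18, by norm_num, ?_⟩
  intro α ι _ _ _ hn p hp ε hε0 hε1 G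
  set C : ℝ := 4 * (21002 ^ 2 + 1) with hC
  set n := Fintype.card α with hnα
  set Y : ℝ := n + Fintype.card ι + 1 / ε with hY
  have hn' : (2 : ℝ) ≤ n := by exact_mod_cast hn
  have hε' : 0 < 1 / ε := by positivity
  have hm0 : (0 : ℝ) ≤ Fintype.card ι := by positivity
  have hnY : (n : ℝ) ≤ Y := by linarith
  have hmY : (Fintype.card ι : ℝ) ≤ Y := by linarith
  have hεY : 1 / ε ≤ Y := by linarith
  have hY1 : 1 ≤ Y := by linarith
  -- The convex combination loses `3 * δ` in the exponent and `2 * δ` in the phases. The independent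
  -- set loses a factor `(1 - δ) ^ 3`, for which this is more than enough.
  set δ := ε / 5 with hδ
  have hδ0 : 0 < δ := by linarith
  have hδ1 : δ < 1 := by linarith
  have hp' : (1 : ℝ) ≤ p := by exact_mod_cast hp
  set L := thresholdCount n δ with hL
  set R := sweepRounds n δ with hR
  set l := Real.log n with hl
  have hlog : 69 / 100 < l := half_lt_log hn
  have hLR : ((L * (R + 1) : ℕ) : ℝ) ≤ 28 * l ^ 2 / δ ^ 2 :=
    thresholdCount_mul_sweepRounds_le hn hδ0 hδ1.le
  have hLpow : (n : ℝ) * (1 - δ) ^ L ≤ δ :=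
    card_mul_pow_thresholdCount_le (by omega) hδ0 hδ1.le
  have hRex : n ≤ R ∨ (1 - δ) ^ R * n < 1 := le_sweepRounds_or (by omega) hδ0 hδ1.le
  have hinit : (n : ℝ) * (1 + 2 * Fintype.card ι) ≤ C * Y ^ 18 := by
    calc (n : ℝ) * (1 + 2 * Fintype.card ι) ≤ Y * (Y + 2 * Y) := by gcongr
      _ = 3 * Y ^ 2 := by ring
      _ ≤ C * Y ^ 18 := by
          gcongr
          · rw [hC]; norm_num
          · norm_num
  -- The additional round is the one spent on the largest singleton value.
  have hrounds : ∀ (r k : ℕ) (B : ℝ), (r : ℝ) ≤ B * (l ^ 2 / δ ^ k) →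
      (3 + B) * 5 ^ k ≤ C →
      ((1 + r : ℕ) : ENNReal) ≤ ENNReal.ofReal (C * l ^ 2 / ε ^ k) := by
    intro r k B hr hB
    rw [← ENNReal.ofReal_natCast]
    refine ENNReal.ofReal_le_ofReal ?_
    have h1 := one_le_log_sq_div hn hδ0 hδ1.le k
    push_cast
    calc (1 : ℝ) + r ≤ 3 * l ^ 2 / δ ^ k + B * (l ^ 2 / δ ^ k) := add_le_add h1 hr
      _ = (3 + B) * 5 ^ k * (l ^ 2 / ε ^ k) := by
          rw [hδ, div_pow]
          field_simp
      _ ≤ C * (l ^ 2 / ε ^ k) := by gcongr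
      _ = C * l ^ 2 / ε ^ k := by ring
  refine ⟨?_, ?_⟩
  -- With `K = 1` and `c = 0` the sample set is deterministic, so one sample gives exact gains and
  -- the error terms vanish.
  · set P : GreedyParams α ι := ⟨G, 1, 1, one_pos, one_pos, δ, R, 0⟩ with hP
    refine ⟨(findMaxSingleton G).bind (P.greedy L), ?_⟩
    intro M f hG hM hf
    have hq : P.queryBound ≤ C * Y ^ 18 := by
      refine queryBound_le hY1 hnY hmY ?_
      simp only [hP, Nat.cast_one]
      have : 1 ≤ Y ^ 16 := one_le_pow₀ hY1
      linarith
    have hens : ((findMaxSingleton G).bind (P.greedy L)).Ensures (matchoidOracle M f)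
        (C * Y ^ 18) M.Indep (1 + L * (R + 1)) := by
      refine AdaptiveAlg.Ensures.bind (fun Λ _ => ?_) (ensures_findMaxSingleton _ hinit)
      exact (P.ensures_greedy hG L Λ).mono_queries hq
    obtain ⟨O, hO, hOopt⟩ := (M.isGreatest_opt f).1
    set Λ := maxSingleton G (matchoidOracle M f) with hΛ
    have hΛ0 : 0 ≤ Λ := maxSingleton_nonneg _
    have hΛO : Λ ≤ f O := by
      rw [hOopt]
      exact maxSingleton_le_opt hf hG
    refine ⟨hens.of_mem_support, ?_, hens.expectedRounds_le.trans ?_,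
      hens.queriesPerRoundLE⟩
    · rw [hens.expectation_eq, AdaptiveAlg.expect_bind, expect_findMaxSingleton, ← hOopt, ← hΛ]
      have hv : ∀ S, P.value f S = f S := by
        intro S
        have h1 : ∀ u : α → Fin 1, sampleSet (bump P.c S) u = S := fun u => by
          ext e
          by_cases he : e ∈ S <;> simp [mem_sampleSet, bump, hP, he]
        change gridValue f 1 _ = _
        rw [gridValue]
        simp only [h1, Fintype.expect_const]
      have h1 := GreedyParams.le_expect_greedy (P := P) (η := 0) (β := 1) (V := 0) (h := f) hf hG
        (fun e => one_pos) hp hM hO hδ0 hδ1 hRex (fun T e _ => by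
          simp [GreedyParams.estimate_eq_gain_of_K_eq_one (P := P) rfl]) le_rfl hΛ0
        (le_maxSingleton hG) L zero_le_one (fun S => by
          rw [hv, hv, hf.normalized]
          change 0 + 1 * (((1 : ℕ) : ℝ) * (f S - 0)) ≤ f S
          simp)
      refine le_trans ?_ h1
      have h2 : (n : ℝ) * ((1 - δ) ^ L * Λ) ≤ δ * f O := by
        calc (n : ℝ) * ((1 - δ) ^ L * Λ) = n * (1 - δ) ^ L * Λ := by ring
          _ ≤ δ * Λ := by gcongr
          _ ≤ δ * f O := by gcongr
      have hf0 := hf.nonneg O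
      simp only [hv, hf.normalized, GreedyParams.roundLoss, mul_zero, sub_zero, zero_add, one_mul]
      change _ ≤ (1 - δ) ^ 2 / (p + 1 / ((1 : ℕ) : ℝ)) * (f O - n * ((1 - δ) ^ L * Λ))
      rw [Nat.cast_one, div_one, div_mul_eq_mul_div, div_mul_eq_mul_div]
      refine div_le_div_of_nonneg_right ?_ (by linarith)
      have h3 : 1 - ε ≤ (1 - δ) ^ 2 * (1 - δ) := by
        have h4 : 0 ≤ δ ^ 2 * (3 - δ) := by
          have : 0 ≤ 3 - δ := by linarith
          positivity
        have h5 : ε = 5 * δ := by rw [hδ]; ring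
        linarith
      calc (1 - ε) * f O ≤ (1 - δ) ^ 2 * (1 - δ) * f O :=
            mul_le_mul_of_nonneg_right h3 hf0
        _ = (1 - δ) ^ 2 * (f O - δ * f O) := by ring
        _ ≤ (1 - δ) ^ 2 * (f O - n * ((1 - δ) ^ L * Λ)) :=
            mul_le_mul_of_nonneg_left (by linarith) (sq_nonneg _)
    · refine hrounds _ 2 28 (hLR.trans_eq (by ring)) ?_
      rw [hC]; norm_num
  · have hKpos : 0 < ⌈1 / δ⌉₊ := Nat.ceil_pos.2 (by positivity)
    have hMpos : 0 < sampleCount n δ := by rw [sampleCount]; positivity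
    -- There is one phase, and one independent set, per unit of `K`. This `K` is large enough for `1
    -- / K ≤ δ` and small enough for `K ≤ 2 / δ = 10 / ε`.
    set P : GreedyParams α ι := ⟨G, ⌈1 / δ⌉₊, sampleCount n δ, hKpos, hMpos, δ, R, 0⟩ with hP
    refine ⟨(findMaxSingleton G).bind fun Λ => phases P L Λ P.K [], ?_⟩
    intro M f hG hM hf
    have hK2 : (P.K : ℝ) ≤ 2 / δ := by
      have h1 := Nat.ceil_lt_add_one (a := 1 / δ) (by positivity)
      have h2 : 1 ≤ 1 / δ := by rw [le_div_iff₀ hδ0]; linarith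
      change ((⌈1 / δ⌉₊ : ℕ) : ℝ) ≤ _
      calc ((⌈1 / δ⌉₊ : ℕ) : ℝ) ≤ 1 / δ + 1 / δ := by linarith
        _ = 2 / δ := by ring
    have hK1 : 1 / δ ≤ P.K := Nat.le_ceil _
    have hK0 : (0 : ℝ) < P.K := by exact_mod_cast hKpos
    have hq : P.queryBound ≤ C * Y ^ 18 :=
      queryBound_le hY1 hnY hmY (sampleCount_le hn hε0 hε1 hnY hεY)
    have hens : ((findMaxSingleton G).bind fun Λ => phases P L Λ P.K []).Ensures
        (matchoidOracle M f) (C * Y ^ 18)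
        (fun w => M.IsConvexCombination w ∧ {S | w S ≠ 0}.ncard ≤ P.K)
        (1 + P.K * (L * (R + 1))) := by
      refine AdaptiveAlg.Ensures.bind (fun Λ _ => ?_) (ensures_findMaxSingleton _ hinit)
      exact (ensures_phases (P := P) hG L Λ P.K (by simp) (by simp)).mono_queries hq
    obtain ⟨O, hO, hOopt⟩ := (M.isGreatest_opt f).1
    set Λ := maxSingleton G (matchoidOracle M f) with hΛ
    have hΛ0 : 0 ≤ Λ := maxSingleton_nonneg _
    have hΛO : Λ ≤ f O := by
      rw [hOopt]
      exact maxSingleton_le_opt hf hG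
    refine ⟨fun w hw => ?_, ?_, hens.expectedRounds_le.trans ?_, hens.queriesPerRoundLE⟩
    · obtain ⟨h1, h2⟩ := hens.of_mem_support w hw
      refine ⟨h1, ?_⟩
      have h3 : (({S | w S ≠ 0}.ncard : ℕ) : ℝ) ≤ P.K := by exact_mod_cast h2
      calc (({S | w S ≠ 0}.ncard : ℕ) : ℝ) ≤ 2 / δ := h3.trans hK2
        _ = 10 / ε := by rw [hδ]; field_simp; norm_num
        _ ≤ C / ε := by
            gcongr
            rw [hC]; norm_num
    · rw [hens.expectation_eq, AdaptiveAlg.expect_bind, expect_findMaxSingleton, ← hOopt, ← hΛ]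
      have h1 := le_expect_phases (P := P) hf hG hp hM hO hδ0 hδ1 hRex hΛ0 (le_maxSingleton hG)
        hΛO L hLpow (le_mul_sqrt_sampleCount n hδ0) P.K (hist := []) (by simp)
      refine le_trans ?_ h1
      have hc0 : (coverCount [] : α → ℕ) = 0 := rfl
      rw [hc0, gridValue_zero hf, sub_zero]
      change _ ≤ f O - (1 - (1 - δ) ^ 2 / (p + 1 / P.K) / P.K) ^ P.K * f O -
        P.K * (2 * δ * f O / P.K)
      have hf0 := hf.nonneg O
      have h2 : P.K * (2 * δ * f O / P.K) = 2 * δ * f O := by field_simp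
      have hKinv : 1 / (P.K : ℝ) ≤ δ := by
        rw [div_le_iff₀ hδ0] at hK1
        rw [div_le_iff₀ hK0]
        linarith
      have h3 : (1 - (1 - δ) ^ 2 / (p + 1 / P.K) / P.K) ^ P.K ≤
          Real.exp (-((1 - δ) ^ 2 / (p + 1 / P.K))) := by
        have hx : (1 - δ) ^ 2 / (p + 1 / P.K) / P.K ≤ 1 := by
          have h4 : (1 - δ) ^ 2 ≤ 1 := pow_le_one₀ (by linarith) (by linarith)
          have h5 : 0 ≤ 1 / (P.K : ℝ) := by positivity
          refine div_le_one_of_le₀ ?_ hK0.le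
          refine (div_le_one_of_le₀ (by linarith) (by linarith)).trans ?_
          exact_mod_cast hKpos
        refine (one_sub_pow_le_exp hx _).trans_eq ?_
        congr 1
        field_simp
      have h4 := exp_neg_div_le hp' hδ0.le (by linarith) (k := 1 / P.K) (by positivity) hKinv
      rw [h2]
      have h5 := mul_le_mul_of_nonneg_right (h3.trans h4) hf0
      rw [show ε = 5 * δ by rw [hδ]; ring]
      linarith
    · refine hrounds _ 3 56 ?_ ?_
      · rw [Nat.cast_mul]
        calc (P.K : ℝ) * ((L * (R + 1) : ℕ) : ℝ) ≤ 2 / δ * (28 * l ^ 2 / δ ^ 2) := by gcongr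
          _ = 56 * (l ^ 2 / δ ^ 3) := by field_simp; norm_num
      · rw [hC]; norm_num
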